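/- For a loopless digraph $D$ (no parallel arcs, digons allowed) and $k\ge 1$, call $D$ $k$-colorable if its vertices can be colored with $k$ colors so that each color class induces a subdigraph without directed cycles. There is a single algorithm which, given an integer $k\ge 1$, a loopless digraph $D$ on $n$ vertices, and a tree decomposition with $N$ nodes and of width $\mathrm{tw}$ of the underlying undirected graph of $D$, decides whether $D$ is $k$-colorable in time $$k^{\mathrm{tw}}\cdot(\mathrm{tw}!)\cdot(n+N)^{O(1)},$$ that is, in time $k^{\mathrm{tw}}(\mathrm{tw}!)\,n^{O(1)}$ when, as usual, the number of nodes of the given decomposition is polynomial in $n$. The constants in $O(1)$ are absolute; in particular they do not depend on $k$ or $\mathrm{tw}$. Here time is the number of elementary steps of a word RAM: if $T$ is the stated time bound, all numbers arising in the computation are at most $(k+T)^{O(1)}$, i.e. words have $O(\log(k+T))$ bits, and arithmetic on words and array access take unit time. The digraph, the tree and the bags are given by $0$-$1$ adjacency and incidence matrices, and $k$ is given as one word. The width is the largest size of a bag minus one (and is counted as $0$ when $n=0$). -/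

import Mathlib

/-! ### Digraph coloring -/

/-- A digraph is acyclic if it has no directed cycle (equivalently, no closed directed walk of
positive length). A digon is a directed cycle. -/
def Digraph.Acyclic {V : Type*} (D : Digraph V) : Prop :=
  ∀ v, ¬ Relation.TransGen D.Adj v v

/-- The subdigraph `D[S]` induced by a set `S` of vertices. -/
def Digraph.inducedOn {V : Type*} (D : Digraph V) (S : Set V) : Digraph S where
  Adj u v := D.Adj u v

/-- `D` is `k`-colorable: its vertices can be colored with `k` colors so that each color class
induces an acyclic subdigraph. -/
def Digraph.DiColorable {V : Type*} (D : Digraph V) (k : ℕ) : Prop :=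
  ∃ c : V → Fin k, ∀ i : Fin k, (D.inducedOn {v | c v = i}).Acyclic

/-! ### Tree decompositions -/

/-- A tree decomposition of `G` whose tree has node set `ι`. -/
structure TreeDecomposition {V : Type*} (G : SimpleGraph V) (ι : Type*) where
  tree : SimpleGraph ι
  isTree : tree.IsTree
  bag : ι → Finset V
  exists_mem_bag : ∀ v, ∃ t, v ∈ bag t
  exists_adj_bag : ∀ u v, G.Adj u v → ∃ t, u ∈ bag t ∧ v ∈ bag t
  preconnected : ∀ v, (tree.induce {t | v ∈ bag t}).Preconnected

/-- The largest size of a bag, minus one. (Only for a graph without vertices are all bags empty;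
the width is then `0` here.) -/
def TreeDecomposition.width {V ι : Type*} [Fintype ι] {G : SimpleGraph V}
    (X : TreeDecomposition G ι) : ℕ :=
  (Finset.univ.sup fun t => (X.bag t).card) - 1

/-! ### Word RAM programs

A program works on finitely many integer variables and finitely many integer arrays, with unit-cost
arithmetic on machine words. -/

namespace WordRAM

/-- The memory: the contents of the variables and of the arrays. -/
structure Mem where
  var : ℕ → ℕ
  arr : ℕ → ℕ → ℕ

/-- Expressions; `get a e` reads entry `e` of array number `a`. -/
inductive Expr where
  | lit (m : ℕ)
  | var (x : ℕ)
  | get (a : ℕ) (e : Expr)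
  | add (e f : Expr)
  | sub (e f : Expr)
  | mul (e f : Expr)
  | div (e f : Expr)

namespace Expr

/-- The value of an expression. Subtraction is truncated at `0`, division is integer division, and
division by `0` gives `0`. -/
def eval (s : Mem) : Expr → ℕ
  | lit m => m
  | var x => s.var x
  | get a e => s.arr a (e.eval s)
  | add e f => e.eval s + f.eval s
  | sub e f => e.eval s - f.eval s
  | mul e f => e.eval s * f.eval s
  | div e f => e.eval s / f.eval s

/-- The number of elementary operations performed to evaluate an expression. -/
def cost : Expr → ℕ
  | lit _ => 1
  | var _ => 1
  | get _ e => e.cost + 1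
  | add e f => e.cost + f.cost + 1
  | sub e f => e.cost + f.cost + 1
  | mul e f => e.cost + f.cost + 1
  | div e f => e.cost + f.cost + 1

/-- All numbers that arise in the evaluation of the expression, including all intermediate results
and all array indices, are at most `W`. -/
def Fits (W : ℕ) (s : Mem) : Expr → Prop
  | lit m => m ≤ W
  | var x => s.var x ≤ W
  | get a e => e.Fits W s ∧ s.arr a (e.eval s) ≤ W
  | add e f => e.Fits W s ∧ f.Fits W s ∧ e.eval s + f.eval s ≤ W
  | sub e f => e.Fits W s ∧ f.Fits W s
  | mul e f => e.Fits W s ∧ f.Fits W s ∧ e.eval s * f.eval s ≤ W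
  | div e f => e.Fits W s ∧ f.Fits W s

end Expr

/-- Programs. `set x e` is `x := e`; `put a e f` is `a[e] := f`; a test is true if its value is
nonzero. -/
inductive Prog where
  | skip
  | set (x : ℕ) (e : Expr)
  | put (a : ℕ) (e f : Expr)
  | seq (p q : Prog)
  | ite (e : Expr) (p q : Prog)
  | while (e : Expr) (p : Prog)

/-- Write to a variable. -/
def Mem.setVar (s : Mem) (x m : ℕ) : Mem :=
  { s with var := Function.update s.var x m }

/-- Write to an array entry. -/
def Mem.setArr (s : Mem) (a i m : ℕ) : Mem :=
  { s with arr := Function.update s.arr a (Function.update (s.arr a) i m) }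

/-- `Run W p s t s'`: started in memory `s`, the program `p` halts after `t` steps in memory `s'`,
and no number larger than `W` arises on the way. (For given `p` and `s` there is at most one such
pair `t`, `s'`.) -/
inductive Run (W : ℕ) : Prog → Mem → ℕ → Mem → Prop where
  | skip (s : Mem) : Run W .skip s 1 s
  | set (s : Mem) (x : ℕ) (e : Expr) (he : e.Fits W s) :
      Run W (.set x e) s (e.cost + 1) (s.setVar x (e.eval s))
  | put (s : Mem) (a : ℕ) (e f : Expr) (he : e.Fits W s) (hf : f.Fits W s) :
      Run W (.put a e f) s (e.cost + f.cost + 1) (s.setArr a (e.eval s) (f.eval s))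
  | seq {p q : Prog} {s s₁ s₂ : Mem} {t₁ t₂ : ℕ} (h₁ : Run W p s t₁ s₁) (h₂ : Run W q s₁ t₂ s₂) :
      Run W (.seq p q) s (t₁ + t₂) s₂
  | ite_true {e : Expr} {p q : Prog} {s s₁ : Mem} {t : ℕ} (he : e.Fits W s) (h : e.eval s ≠ 0)
      (hp : Run W p s t s₁) : Run W (.ite e p q) s (e.cost + 1 + t) s₁
  | ite_false {e : Expr} {p q : Prog} {s s₁ : Mem} {t : ℕ} (he : e.Fits W s) (h : e.eval s = 0)
      (hq : Run W q s t s₁) : Run W (.ite e p q) s (e.cost + 1 + t) s₁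
  | while_true {e : Expr} {p : Prog} {s s₁ s₂ : Mem} {t₁ t₂ : ℕ} (he : e.Fits W s)
      (h : e.eval s ≠ 0) (hp : Run W p s t₁ s₁) (hw : Run W (.while e p) s₁ t₂ s₂) :
      Run W (.while e p) s (e.cost + 1 + t₁ + t₂) s₂
  | while_false {e : Expr} {p : Prog} {s : Mem} (he : e.Fits W s) (h : e.eval s = 0) :
      Run W (.while e p) s (e.cost + 1) s

end WordRAM

/-! ### The input and the time bound -/

open Classical in
/-- The row-major array of a `0`-`1` matrix with `m` columns, padded with zeros. -/
noncomputable def matrixArray {l m : ℕ} (R : Fin l → Fin m → Prop) (i : ℕ) : ℕ :=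
  if ∃ (u : Fin l) (v : Fin m), i = u * m + v ∧ R u v then 1 else 0

/-- The memory that holds the input: variables `0`, `1`, `2` hold the number `n` of vertices, the
number `N` of nodes of the tree, and `k`; array `0` is the adjacency matrix of the digraph, array
`1` the adjacency matrix of the tree, array `2` the incidence matrix of bags and vertices.
Everything else is `0`. -/
noncomputable def inputMem {n N : ℕ} (D : Digraph (Fin n))
    (X : TreeDecomposition D.toSimpleGraphInclusive (Fin N)) (k : ℕ) : WordRAM.Mem where
  var
    | 0 => n
    | 1 => N
    | 2 => k
    | _ => 0
  arr
    | 0 => matrixArray D.Adj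
    | 1 => matrixArray X.tree.Adj
    | 2 => matrixArray fun t v => v ∈ X.bag t
    | _ => fun _ => 0

/-- The function `C · k ^ w · w! · m ^ C`. -/
def timeBound (C k w m : ℕ) : ℕ :=
  C * (k ^ w * w.factorial * m ^ C)

/-! A coloring has acyclic classes exactly when some linear order of all vertices makes every arc
with equally colored ends point forward, because an acyclic relation has a linear extension. So one
looks for a coloring together with a linear order, and this can be done bag by bag. A state of a
node is a coloring and a linear order of its bag. A bag with b vertices has k^b · b! states,
numbered in mixed radix with one digit (color, rank among the smaller vertices) per vertex.

States are filtered in rounds. A valid state survives if every neighboring node has a state that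
survived the previous round and agrees with it on the common vertices. Restrictions of a global
solution survive forever (`RawInput.Matches.alive`). Conversely, a single state of one node that
survives N rounds suffices. With this node as root, no depth exceeds N, so states that agree along
all tree edges can be chosen from the root downwards (`ParentTree.exists_assignment`). The colors
fit together because the nodes containing a vertex are connected.

The union of the chosen bag orders is acyclic (`ParentTree.not_transGen_exists`). To see this,
remove a deepest node. The vertices it shares with the rest lie in its parent's bag, where the order
is the same, so excursions through the removed bag can be replaced by steps of the remaining
relation (`not_transGen_union`). Every monochromatic arc lies in some bag and points forward there,
so no color class contains a directed cycle.

The surviving states send a code of their restriction to the common vertices into a table. A state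
therefore checks a neighbor by one lookup, and pairs of states are never compared, which would
square the count. A bag has at most k^(tw+1) · (tw+1)! states. The surplus factor k(tw+1) is at most
n² when k < n, and for k ≥ n the answer is yes by giving all vertices distinct colors. The remaining
work is polynomial in n + N. All memory cells stay below one bound Z, and expressions have bounded
size, so intermediate values stay below Z^64. -/

namespace WordRAM

/-! ### Reasoning about programs -/

@[simp] theorem Mem.setVar_var (s : Mem) (x m y : ℕ) :
    (s.setVar x m).var y = if y = x then m else s.var y := by
  simp [Mem.setVar, Function.update_apply]

@[simp] theorem Mem.setVar_arr (s : Mem) (x m : ℕ) : (s.setVar x m).arr = s.arr := rfl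

@[simp] theorem Mem.setArr_var (s : Mem) (a i m : ℕ) : (s.setArr a i m).var = s.var := rfl

@[simp] theorem Mem.setArr_arr (s : Mem) (a i m b j : ℕ) :
    (s.setArr a i m).arr b j = if b = a ∧ j = i then m else s.arr b j := by
  simp only [Mem.setArr, Function.update_apply]
  split_ifs with h₁ h₂ h₂ <;> simp_all

/-- All memory cells are at most `Z`. -/
structure Mem.Bdd (Z : ℕ) (s : Mem) : Prop where
  two_le : 2 ≤ Z
  var_le : ∀ x, s.var x ≤ Z
  arr_le : ∀ a i, s.arr a i ≤ Z

theorem Mem.Bdd.setVar {Z : ℕ} {s : Mem} (h : s.Bdd Z) (x : ℕ) {m : ℕ} (hm : m ≤ Z) :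
    (s.setVar x m).Bdd Z := by
  refine ⟨h.1, fun y => ?_, h.3⟩
  rw [Mem.setVar_var]
  split_ifs
  exacts [hm, h.2 y]

theorem Mem.Bdd.setArr {Z : ℕ} {s : Mem} (h : s.Bdd Z) (a i : ℕ) {m : ℕ} (hm : m ≤ Z) :
    (s.setArr a i m).Bdd Z := by
  refine ⟨h.1, h.2, fun b j => ?_⟩
  rw [Mem.setArr_arr]
  split_ifs
  exacts [hm, h.3 b j]

/-! ### Word size of expressions. -/

namespace Expr

/-- All literals of the expression are at most `2`. -/
def smallLits : Expr → Bool
  | lit m => decide (m ≤ 2)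
  | var _ => true
  | get _ e => e.smallLits
  | add e f => e.smallLits && f.smallLits
  | sub e f => e.smallLits && f.smallLits
  | mul e f => e.smallLits && f.smallLits
  | div e f => e.smallLits && f.smallLits

theorem one_le_cost (e : Expr) : 1 ≤ e.cost := by
  cases e <;> simp [cost]

/-- Products add the exponents of Z, and since 2 ≤ Z a sum raises the larger exponent by at most
one. The cost of an expression thus bounds the exponent of every intermediate value. -/
theorem eval_le_and_fits {Z : ℕ} {s : Mem} (hs : s.Bdd Z) (e : Expr) (h : e.smallLits = true) :
    e.eval s ≤ Z ^ e.cost ∧ ∀ c, e.cost ≤ c → e.Fits (Z ^ c) s := by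
  have hZ := hs.two_le
  have hZ0 : 0 < Z := by omega
  have one : ∀ c, 1 ≤ c → Z ≤ Z ^ c := fun c hc => Nat.le_self_pow (by omega) Z
  have mono : ∀ {a b}, a ≤ b → Z ^ a ≤ Z ^ b := fun hab => Nat.pow_le_pow_right hZ0 hab
  induction e with
  | lit m =>
    simp only [smallLits, decide_eq_true_eq] at h
    exact ⟨by simp [eval, cost]; omega, fun c hc => (h.trans hZ).trans (one c hc)⟩
  | var x =>
    exact ⟨by simpa [eval, cost] using hs.2 x, fun c hc => (hs.2 x).trans (one c hc)⟩
  | get a e ih =>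
    have ih := ih h
    refine ⟨(hs.3 _ _).trans (one _ (one_le_cost _)), fun c hc => ⟨ih.2 c ?_, ?_⟩⟩
    · simp only [cost] at hc; omega
    · exact (hs.3 _ _).trans (one _ ((one_le_cost _).trans hc))
  | add e f ihe ihf =>
    simp only [smallLits, Bool.and_eq_true] at h
    have ihe := ihe h.1
    have ihf := ihf h.2
    have key : e.eval s + f.eval s ≤ Z ^ (e.cost + f.cost + 1) := by
      calc e.eval s + f.eval s ≤ Z ^ (e.cost + f.cost) + Z ^ (e.cost + f.cost) :=
            Nat.add_le_add (ihe.1.trans (mono (by omega))) (ihf.1.trans (mono (by omega)))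
        _ = Z ^ (e.cost + f.cost) * 2 := by ring
        _ ≤ Z ^ (e.cost + f.cost) * Z := Nat.mul_le_mul_left _ hZ
        _ = _ := by rw [pow_succ]
    refine ⟨key, fun c hc => ⟨ihe.2 c ?_, ihf.2 c ?_, key.trans (mono hc)⟩⟩ <;>
      simp only [cost] at hc <;> omega
  | sub e f ihe ihf =>
    simp only [smallLits, Bool.and_eq_true] at h
    have ihe := ihe h.1
    have ihf := ihf h.2
    refine ⟨(Nat.sub_le _ _).trans (ihe.1.trans (mono (by simp only [cost]; omega))),
      fun c hc => ⟨ihe.2 c ?_, ihf.2 c ?_⟩⟩ <;>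
      simp only [cost] at hc <;> omega
  | mul e f ihe ihf =>
    simp only [smallLits, Bool.and_eq_true] at h
    have ihe := ihe h.1
    have ihf := ihf h.2
    have key : e.eval s * f.eval s ≤ Z ^ (e.cost + f.cost + 1) := by
      calc e.eval s * f.eval s ≤ Z ^ e.cost * Z ^ f.cost := Nat.mul_le_mul ihe.1 ihf.1
        _ = Z ^ (e.cost + f.cost) := by rw [pow_add]
        _ ≤ _ := mono (by omega)
    refine ⟨key, fun c hc => ⟨ihe.2 c ?_, ihf.2 c ?_, key.trans (mono hc)⟩⟩ <;>
      simp only [cost] at hc <;> omega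
  | div e f ihe ihf =>
    simp only [smallLits, Bool.and_eq_true] at h
    have ihe := ihe h.1
    have ihf := ihf h.2
    refine ⟨(Nat.div_le_self _ _).trans (ihe.1.trans (mono (by simp only [cost]; omega))),
      fun c hc => ⟨ihe.2 c ?_, ihf.2 c ?_⟩⟩ <;>
      simp only [cost] at hc <;> omega

/-- The literals are at most `2` and the cost is at most `64`. -/
def small (e : Expr) : Bool := e.smallLits && decide (e.cost ≤ 64)

theorem fits_of_small {Z : ℕ} {s : Mem} (hs : s.Bdd Z) {e : Expr} (h : e.small = true) :
    e.Fits (Z ^ 64) s := by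
  simp only [small, Bool.and_eq_true, decide_eq_true_eq] at h
  exact (eval_le_and_fits hs e h.1).2 64 h.2

end Expr

/-! ### Syntactic frame rule. -/

/-- Whether the program contains an assignment to the variable `x`. -/
def Prog.writesVar : Prog → ℕ → Bool
  | .skip, _ => false
  | .set y _, x => x == y
  | .put _ _ _, _ => false
  | .seq p q, x => p.writesVar x || q.writesVar x
  | .ite _ p q, x => p.writesVar x || q.writesVar x
  | .while _ p, x => p.writesVar x

/-- Whether the program contains an assignment to an entry of the array `a`. -/
def Prog.writesArr : Prog → ℕ → Bool
  | .skip, _ => false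
  | .set _ _, _ => false
  | .put b _ _, a => a == b
  | .seq p q, a => p.writesArr a || q.writesArr a
  | .ite _ p q, a => p.writesArr a || q.writesArr a
  | .while _ p, a => p.writesArr a

/-- The memories agree except where the program may write. -/
structure Frame (p : Prog) (s s' : Mem) : Prop where
  var : ∀ x, p.writesVar x = false → s'.var x = s.var x
  arr : ∀ a, p.writesArr a = false → s'.arr a = s.arr a

theorem Frame.refl (p : Prog) (s : Mem) : Frame p s s := ⟨fun _ _ => rfl, fun _ _ => rfl⟩

theorem Frame.trans {p : Prog} {s₁ s₂ s₃ : Mem} (h : Frame p s₁ s₂) (h' : Frame p s₂ s₃) :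
    Frame p s₁ s₃ :=
  ⟨fun x hx => (h'.1 x hx).trans (h.1 x hx), fun a ha => (h'.2 a ha).trans (h.2 a ha)⟩

theorem Frame.mono {p q : Prog} {s s' : Mem} (h : Frame p s s')
    (hv : ∀ x, q.writesVar x = false → p.writesVar x = false)
    (ha : ∀ a, q.writesArr a = false → p.writesArr a = false) : Frame q s s' :=
  ⟨fun x hx => h.1 x (hv x hx), fun a h' => h.2 a (ha a h')⟩

/-- The write sets are computed from the program text, so later proofs can discharge "this cell is
unchanged" by `rfl`. -/
theorem Run.frame {W : ℕ} {p : Prog} {s s' : Mem} {t : ℕ} (h : Run W p s t s') :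
    Frame p s s' := by
  induction h with
  | skip s => exact .refl _ _
  | set s x e he =>
    refine ⟨fun y hy => ?_, fun _ _ => rfl⟩
    simp only [Prog.writesVar, beq_eq_false_iff_ne] at hy
    simp [hy]
  | put s a e f he hf =>
    refine ⟨fun _ _ => rfl, fun b hb => ?_⟩
    simp only [Prog.writesArr, beq_eq_false_iff_ne] at hb
    funext j
    simp [hb]
  | seq _ _ ih₁ ih₂ =>
    refine (ih₁.mono ?_ ?_).trans (ih₂.mono ?_ ?_) <;>
      simp +contextual [Prog.writesVar, Prog.writesArr]
  | ite_true _ _ _ ih => refine ih.mono ?_ ?_ <;> simp +contextual [Prog.writesVar, Prog.writesArr]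
  | ite_false _ _ _ ih => refine ih.mono ?_ ?_ <;> simp +contextual [Prog.writesVar, Prog.writesArr]
  | while_true _ _ _ _ ih₁ ih₂ =>
    exact (ih₁.mono (q := .while _ _) (fun _ h => h) (fun _ h => h)).trans ih₂
  | while_false _ _ => exact .refl _ _

/-! ### Total-correctness triples with time and size bounds. -/

/-- Started in the memory `s`, whose cells are at most `Z`, the program `p` halts after at most `T`
steps in a memory with the property `Q` whose cells are at most `Z`; only numbers polynomial in `Z`
arise. -/
def Spec (Z : ℕ) (p : Prog) (s : Mem) (T : ℕ) (Q : Mem → Prop) : Prop :=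
  s.Bdd Z → ∃ t s', Run (Z ^ 64) p s t s' ∧ t ≤ T ∧ s'.Bdd Z ∧ Q s'

namespace Spec

variable {Z : ℕ} {p q : Prog} {s : Mem} {T T' T₁ T₂ : ℕ} {Q Q' : Mem → Prop}

theorem le (h : Spec Z p s T Q) (hT : T ≤ T') : Spec Z p s T' Q := fun hs => by
  obtain ⟨t, s', h₁, h₂, h₃, h₄⟩ := h hs
  exact ⟨t, s', h₁, h₂.trans hT, h₃, h₄⟩

theorem imp (h : Spec Z p s T Q) (hQ : ∀ s', s'.Bdd Z → Frame p s s' → Q s' → Q' s') :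
    Spec Z p s T Q' := fun hs => by
  obtain ⟨t, s', h₁, h₂, h₃, h₄⟩ := h hs
  exact ⟨t, s', h₁, h₂, h₃, hQ s' h₃ h₁.frame h₄⟩

theorem of_bdd (h : s.Bdd Z → Spec Z p s T Q) : Spec Z p s T Q := fun hs => h hs hs

theorem skip (h : Q s) : Spec Z .skip s 1 Q := fun hs =>
  ⟨_, _, .skip s, le_rfl, hs, h⟩

theorem set {x : ℕ} {e : Expr} {m : ℕ} (he : e.small = true) (hm : e.eval s = m) (hv : m ≤ Z)
    (h : Q (s.setVar x m)) : Spec Z (.set x e) s (e.cost + 1) Q := fun hs => by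
  subst hm
  exact ⟨_, _, .set s x e (Expr.fits_of_small hs he), le_rfl, hs.setVar x hv, h⟩

theorem put {a : ℕ} {e f : Expr} {i m : ℕ} (he : e.small = true) (hf : f.small = true)
    (hi : e.eval s = i) (hm : f.eval s = m) (hv : m ≤ Z) (h : Q (s.setArr a i m)) :
    Spec Z (.put a e f) s (e.cost + f.cost + 1) Q := fun hs => by
  subst hi hm
  exact ⟨_, _, .put s a e f (Expr.fits_of_small hs he) (Expr.fits_of_small hs hf), le_rfl,
    hs.setArr a _ hv, h⟩

theorem seq (h₁ : Spec Z p s T₁ Q')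
    (h₂ : ∀ s', s'.Bdd Z → Frame p s s' → Q' s' → Spec Z q s' T₂ Q) :
    Spec Z (.seq p q) s (T₁ + T₂) Q := fun hs => by
  obtain ⟨t₁, s₁, r₁, l₁, b₁, q₁⟩ := h₁ hs
  obtain ⟨t₂, s₂, r₂, l₂, b₂, q₂⟩ := h₂ s₁ b₁ r₁.frame q₁ b₁
  exact ⟨_, s₂, .seq r₁ r₂, Nat.add_le_add l₁ l₂, b₂, q₂⟩

theorem set_seq {x : ℕ} {e : Expr} (m : ℕ) (he : e.small = true) (hm : e.eval s = m) (hv : m ≤ Z)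
    (h : Spec Z q (s.setVar x m) T Q) :
    Spec Z (.seq (.set x e) q) s (e.cost + 1 + T) Q :=
  (set he hm hv (Q := fun s' => s' = s.setVar x m) rfl).seq
    fun s' _ _ hs' => by rw [hs']; exact h

theorem put_seq {a : ℕ} {e f : Expr} (i m : ℕ) (he : e.small = true) (hf : f.small = true)
    (hi : e.eval s = i) (hm : f.eval s = m) (hv : m ≤ Z) (h : Spec Z q (s.setArr a i m) T Q) :
    Spec Z (.seq (.put a e f) q) s (e.cost + f.cost + 1 + T) Q :=
  (put he hf hi hm hv (Q := fun s' => s' = s.setArr a i m) rfl).seq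
    fun s' _ _ hs' => by rw [hs']; exact h

theorem ite {e : Expr} (he : e.small = true) (hp : e.eval s ≠ 0 → Spec Z p s T Q)
    (hq : e.eval s = 0 → Spec Z q s T Q) : Spec Z (.ite e p q) s (e.cost + 1 + T) Q := fun hs => by
  by_cases h : e.eval s = 0
  · obtain ⟨t, s', h₁, h₂, h₃, h₄⟩ := hq h hs
    exact ⟨_, s', .ite_false (Expr.fits_of_small hs he) h h₁, by omega, h₃, h₄⟩
  · obtain ⟨t, s', h₁, h₂, h₃, h₄⟩ := hp h hs
    exact ⟨_, s', .ite_true (Expr.fits_of_small hs he) h h₁, by omega, h₃, h₄⟩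

end Spec

/-- Run `p` with the variable `x` ranging over the numbers below the value of the variable `y`. -/
def forLoop (x y : ℕ) (p : Prog) : Prog :=
  .seq (.set x (.lit 0))
    (.while (.sub (.var y) (.var x)) (.seq p (.set x (.add (.var x) (.lit 1)))))

/-- Induction on the number `j` of iterations left. The 8 extra steps per iteration are 4 for the
test and 4 for the increment; the final failing test costs 4. The invariant is stated after the
increment because it may not survive a change of the counter automatically. -/
theorem Spec.while_up {Z : ℕ} {x y m T : ℕ} {p : Prog} (hxy : x ≠ y)
    (hx : p.writesVar x = false) (hy : p.writesVar y = false) (I : ℕ → Mem → Prop)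
    {s₀ : Mem}
    (step : ∀ i < m, ∀ s, s.Bdd Z → Frame (forLoop x y p) s₀ s → s.var x = i → s.var y = m →
      I i s → Spec Z p s T fun s' => I (i + 1) (s'.setVar x (i + 1))) (j : ℕ) :
    ∀ i, i + j = m → ∀ s, Frame (forLoop x y p) s₀ s → s.var x = i → s.var y = m → I i s →
      Spec Z (.while (.sub (.var y) (.var x)) (.seq p (.set x (.add (.var x) (.lit 1))))) s
        (4 + j * (T + 8)) fun s' => I m s' ∧ s'.var x = m := by
  induction j with
  | zero =>
    intro i hi s _ hsx hsy hI hs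
    refine ⟨_, s, .while_false (Expr.fits_of_small hs rfl) ?_, by simp [Expr.cost], hs, ?_, ?_⟩
    · simp only [Expr.eval]; omega
    · rwa [← hi]
    · omega
  | succ j ih =>
    intro i hi s hF hsx hsy hI hs
    obtain ⟨t₁, s₁, r₁, l₁, b₁, q₁⟩ := step i (by omega) s hs hF hsx hsy hI hs
    have hx₁ : s₁.var x = i := (r₁.frame.1 x hx).trans hsx
    have hy₁ : s₁.var y = m := (r₁.frame.1 y hy).trans hsy
    -- The counter never exceeds the loop bound, which is itself a memory cell and hence at most
    -- `Z`.
    have hb : i + 1 ≤ Z := (by omega : i + 1 ≤ m).trans (hsy ▸ hs.2 y)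
    have he : Expr.eval s₁ (.add (.var x) (.lit 1)) = i + 1 := by simp [Expr.eval, hx₁]
    have r₂ : Run (Z ^ 64) (.seq p (.set x (.add (.var x) (.lit 1)))) s (t₁ + 4)
        (s₁.setVar x (i + 1)) := by
      have := Run.set (W := Z ^ 64) s₁ x (.add (.var x) (.lit 1)) (Expr.fits_of_small b₁ rfl)
      rw [he] at this
      exact .seq r₁ this
    have hF₂ : Frame (forLoop x y p) s (s₁.setVar x (i + 1)) := by
      refine r₂.frame.mono ?_ ?_ <;>
        simp +contextual [forLoop, Prog.writesVar, Prog.writesArr]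
    obtain ⟨t₂, s₂, r₃, l₃, b₃, q₃⟩ := ih (i + 1) (by omega) (s₁.setVar x (i + 1))
      (hF.trans hF₂) (by simp) (by simp [hxy.symm, hy₁]) q₁ (b₁.setVar x hb)
    refine ⟨_, s₂, .while_true (Expr.fits_of_small hs rfl) ?_ r₂ r₃, ?_, b₃, q₃⟩
    · simp only [Expr.eval]; omega
    · simp only [Expr.cost]
      have : (j + 1) * (T + 8) = j * (T + 8) + (T + 8) := by ring
      omega

theorem Spec.forLoop {Z : ℕ} {x y m T : ℕ} {p : Prog} {s : Mem} (hxy : x ≠ y)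
    (hx : p.writesVar x = false) (hy : p.writesVar y = false) (hm : s.var y = m)
    (I : ℕ → Mem → Prop) (h0 : I 0 (s.setVar x 0))
    (step : ∀ i < m, ∀ s', s'.Bdd Z → Frame (forLoop x y p) s s' → s'.var x = i → s'.var y = m →
      I i s' → Spec Z p s' T fun s'' => I (i + 1) (s''.setVar x (i + 1))) :
    Spec Z (forLoop x y p) s (6 + m * (T + 8)) fun s' => I m s' ∧ s'.var x = m := by
  refine Spec.le (Spec.set_seq 0 rfl rfl (by simp) 
    (Spec.while_up (s₀ := s) hxy hx hy I step m 0 (by simp) (s.setVar x 0) ?_ (by simp)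
      (by simpa [hxy.symm] using hm) h0)) (by simp [Expr.cost]; omega)
  refine ⟨fun z hz => ?_, fun _ _ => rfl⟩
  simp only [WordRAM.forLoop, Prog.writesVar, Bool.or_eq_false_iff, beq_eq_false_iff_ne] at hz
  simp [hz.1]

end WordRAM

/-! ### Codes of colored linear orders

For a set `B` of natural numbers, a coloring of `B` with `k` colors and a linear order of `B` (given
by an injective function on `B`) is encoded by one number. -/

section Codes

open Classical

/-- The number of elements of `B` below `v`. -/
noncomputable def cntBelow (B : ℕ → Prop) (v : ℕ) : ℕ := Nat.count B v

/-- The number of elements of `B` below `v` that `p` places before `v`. -/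
noncomputable def cntBefore (B : ℕ → Prop) (p : ℕ → ℕ) (v : ℕ) : ℕ :=
  Nat.count (fun u => B u ∧ p u < p v) v

/-- The number of colorings and orders of the elements of `B` below `v`. -/
noncomputable def codeCard (B : ℕ → Prop) (k v : ℕ) : ℕ :=
  k ^ cntBelow B v * (cntBelow B v).factorial

/-- The digit of the code `σ` that describes the color and the rank of `v`. -/
noncomputable def codeDigit (B : ℕ → Prop) (k σ v : ℕ) : ℕ :=
  σ / codeCard B k v % (k * (cntBelow B v + 1))

/-- The color of `v` according to the code `σ`. -/
noncomputable def codeCol (B : ℕ → Prop) (k σ v : ℕ) : ℕ :=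
  codeDigit B k σ v / (cntBelow B v + 1)

/-- The rank of `v` among the smaller elements of `B` according to the code `σ`. -/
noncomputable def codeRank (B : ℕ → Prop) (k σ v : ℕ) : ℕ :=
  codeDigit B k σ v % (cntBelow B v + 1)

/-- The positions of the elements of `B` below `v` if they are inserted one after the other at the
given ranks. -/
noncomputable def insertPos (B : ℕ → Prop) (r : ℕ → ℕ) : ℕ → ℕ → ℕ
  | 0, _ => 0
  | v + 1, u =>
    if B v then
      if u = v then r v
      else if r v ≤ insertPos B r v u then insertPos B r v u + 1 else insertPos B r v u
    else insertPos B r v u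

/-- The code of the restriction of a coloring and an order to the elements of `S` below `v`. -/
noncomputable def codeOf (S : ℕ → Prop) (k : ℕ) (c p : ℕ → ℕ) : ℕ → ℕ
  | 0 => 0
  | v + 1 =>
    if S v then
      codeOf S k c p v * (k * (cntBelow S v + 1)) + (c v * (cntBelow S v + 1) + cntBefore S p v)
    else codeOf S k c p v

variable {B S : ℕ → Prop} {k : ℕ}

@[simp] theorem cntBelow_zero (B : ℕ → Prop) : cntBelow B 0 = 0 := by simp [cntBelow]

theorem cntBelow_succ (B : ℕ → Prop) (v : ℕ) :
    cntBelow B (v + 1) = if B v then cntBelow B v + 1 else cntBelow B v := by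
  simp only [cntBelow, Nat.count_succ]
  split_ifs <;> rfl

theorem cntBelow_le (B : ℕ → Prop) (v : ℕ) : cntBelow B v ≤ v := by
  simpa [cntBelow] using Nat.count_le (p := B) (n := v)

theorem cntBelow_mono (B : ℕ → Prop) {v w : ℕ} (h : v ≤ w) : cntBelow B v ≤ cntBelow B w :=
  Nat.count_monotone B h

theorem cntBelow_mono_set {B S : ℕ → Prop} (h : ∀ v, S v → B v) (v : ℕ) :
    cntBelow S v ≤ cntBelow B v :=
  Nat.count_mono_left fun x _ => h x

theorem cntBefore_le (B : ℕ → Prop) (p : ℕ → ℕ) (v : ℕ) : cntBefore B p v ≤ cntBelow B v :=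
  Nat.count_mono_left fun _ _ h => h.1

@[simp] theorem codeCard_zero (B : ℕ → Prop) (k : ℕ) : codeCard B k 0 = 1 := by simp [codeCard]

/-- The product of the radices k(i+1) over i < m is k^m · m!, so `codeCard` is both the place value
of the digit at `v` and the number of codes below `v`. -/
theorem codeCard_succ (B : ℕ → Prop) (k v : ℕ) :
    codeCard B k (v + 1) =
      if B v then codeCard B k v * (k * (cntBelow B v + 1)) else codeCard B k v := by
  simp only [codeCard, cntBelow_succ]
  split_ifs
  · rw [pow_succ, Nat.factorial_succ]; ring
  · rfl

theorem codeCard_pos (B : ℕ → Prop) (hk : 1 ≤ k) (v : ℕ) : 0 < codeCard B k v :=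
  Nat.mul_pos (Nat.pow_pos hk) (Nat.factorial_pos _)

theorem codeCard_le {B S : ℕ → Prop} (hk : 1 ≤ k) {v w : ℕ} (h : cntBelow S v ≤ cntBelow B w) :
    codeCard S k v ≤ codeCard B k w :=
  Nat.mul_le_mul (Nat.pow_le_pow_right hk h) (Nat.factorial_le h)

theorem codeCard_mono (B : ℕ → Prop) (hk : 1 ≤ k) {v w : ℕ} (h : v ≤ w) :
    codeCard B k v ≤ codeCard B k w :=
  codeCard_le hk (cntBelow_mono B h)

theorem codeDigit_lt (B : ℕ → Prop) (hk : 1 ≤ k) (σ v : ℕ) :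
    codeDigit B k σ v < k * (cntBelow B v + 1) :=
  Nat.mod_lt _ (Nat.mul_pos hk (Nat.succ_pos _))

theorem codeCol_lt (B : ℕ → Prop) (hk : 1 ≤ k) (σ v : ℕ) : codeCol B k σ v < k :=
  Nat.div_lt_of_lt_mul (by rw [mul_comm]; exact codeDigit_lt B hk σ v)

theorem codeRank_le (B : ℕ → Prop) (k σ v : ℕ) : codeRank B k σ v ≤ cntBelow B v :=
  Nat.lt_succ_iff.mp (Nat.mod_lt _ (Nat.succ_pos _))

/-! #### Decoding -/

/-- A new top digit is added with weight `codeCard B k n`. Each earlier place value times its radix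
divides this weight, so the earlier digits do not change. Only this surjectivity of decoding is
needed; no uniqueness of codes is used. -/
theorem exists_code_of_digits (hk : 1 ≤ k) (d : ℕ → ℕ)
    (hd : ∀ v, d v < k * (cntBelow B v + 1)) (n : ℕ) :
    ∃ σ < codeCard B k n, ∀ v < n, B v → codeDigit B k σ v = d v := by
  induction n with
  | zero => exact ⟨0, by simp, by simp⟩
  | succ n ih =>
    obtain ⟨σ, hσ, h⟩ := ih
    by_cases hB : B n
    · refine ⟨σ + codeCard B k n * d n, ?_, fun v hv hv' => ?_⟩
      · rw [codeCard_succ, if_pos hB]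
        calc σ + codeCard B k n * d n < codeCard B k n + codeCard B k n * d n := by omega
          _ = codeCard B k n * (d n + 1) := by ring
          _ ≤ _ := Nat.mul_le_mul_left _ (hd n)
      · rcases (Nat.lt_succ_iff_lt_or_eq.mp hv) with hv | rfl
        · have hdvd : codeCard B k v * (k * (cntBelow B v + 1)) ∣ codeCard B k n := by
            have : codeCard B k v * (k * (cntBelow B v + 1)) = codeCard B k (v + 1) := by
              rw [codeCard_succ, if_pos hv']
            rw [this]
            have hle := cntBelow_mono B (Nat.succ_le_of_lt hv)
            exact Nat.mul_dvd_mul (pow_dvd_pow _ hle) (Nat.factorial_dvd_factorial hle)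
          obtain ⟨z, hz⟩ := hdvd
          rw [← h v hv hv', codeDigit, codeDigit, hz, mul_assoc, mul_assoc,
            Nat.add_mul_div_left _ _ (codeCard_pos B hk v), mul_assoc, ← mul_assoc k,
            Nat.add_mul_mod_self_left]
        · rw [codeDigit, Nat.add_mul_div_left _ _ (codeCard_pos B hk v), Nat.div_eq_of_lt hσ,
            zero_add, Nat.mod_eq_of_lt (hd v)]
    · refine ⟨σ, by rwa [codeCard_succ, if_neg hB], fun v hv hv' => ?_⟩
      rcases (Nat.lt_succ_iff_lt_or_eq.mp hv) with hv | rfl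
      exacts [h v hv hv', absurd hv' hB]

theorem insertPos_lt (r : ℕ → ℕ) (hr : ∀ v, r v ≤ cntBelow B v) (n : ℕ) :
    ∀ u < n, B u → insertPos B r n u < cntBelow B n := by
  induction n with
  | zero => simp
  | succ n ih =>
    intro u hu hBu
    have hn := hr n
    rcases (Nat.lt_succ_iff_lt_or_eq.mp hu) with hu | rfl
    · have := ih u hu hBu
      simp only [insertPos, cntBelow_succ, if_neg hu.ne]
      split_ifs <;> omega
    · simp only [insertPos, cntBelow_succ, if_pos hBu, if_true]
      omega

/-- Later insertions shift a final segment of positions by one, which preserves the relative order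
of the earlier elements. -/
theorem insertPos_succ_lt_iff (r : ℕ → ℕ) {n u v : ℕ} (hu : u < n) (hv : v < n) :
    insertPos B r (n + 1) u < insertPos B r (n + 1) v ↔ insertPos B r n u < insertPos B r n v := by
  simp only [insertPos, if_neg hu.ne, if_neg hv.ne]
  split_ifs <;> omega

theorem insertPos_injOn (r : ℕ → ℕ) (n : ℕ) :
    ∀ u < n, ∀ v < n, B u → B v → insertPos B r n u = insertPos B r n v → u = v := by
  induction n with
  | zero => simp
  | succ n ih =>
    intro u hu v hv hBu hBv h
    rcases (Nat.lt_succ_iff_lt_or_eq.mp hu) with hu | rfl <;>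
      rcases (Nat.lt_succ_iff_lt_or_eq.mp hv) with hv | rfl
    · refine ih u hu v hv hBu hBv ?_
      simp only [insertPos, if_neg hu.ne, if_neg hv.ne] at h
      split_ifs at h <;> omega
    · simp only [insertPos, if_neg hu.ne, if_pos hBv, if_true] at h
      split_ifs at h <;> omega
    · simp only [insertPos, if_neg hv.ne, if_pos hBu, if_true] at h
      split_ifs at h <;> omega
    · rfl

/-- The positions are distinct and below the number of elements, so they fill an initial segment of
the naturals without gaps. -/
theorem count_insertPos_lt (r : ℕ → ℕ) (hr : ∀ v, r v ≤ cntBelow B v) (n : ℕ) :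
    ∀ j ≤ cntBelow B n, Nat.count (fun u => B u ∧ insertPos B r n u < j) n = j := by
  intro j hj
  have hcard : ((Finset.range n).filter B).card = cntBelow B n := by
    rw [cntBelow, Nat.count_eq_card_filter_range]
  have hinj : Set.InjOn (insertPos B r n) ((Finset.range n).filter B) := by
    intro u hu v hv h
    simp only [Finset.coe_filter, Finset.mem_range, Set.mem_ofPred_eq] at hu hv
    exact insertPos_injOn r n u hu.1 v hv.1 hu.2 hv.2 h
  have himg : ((Finset.range n).filter B).image (insertPos B r n) = Finset.range (cntBelow B n) := by
    refine Finset.eq_of_subset_of_card_le ?_ ?_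
    · intro x hx
      simp only [Finset.mem_image, Finset.mem_filter, Finset.mem_range] at hx ⊢
      obtain ⟨u, ⟨hu, hBu⟩, rfl⟩ := hx
      exact insertPos_lt r hr n u hu hBu
    · rw [Finset.card_image_of_injOn hinj, hcard, Finset.card_range]
  have : ((Finset.range n).filter fun u => B u ∧ insertPos B r n u < j).image (insertPos B r n)
      = Finset.range j := by
    ext x
    simp only [Finset.mem_image, Finset.mem_filter, Finset.mem_range]
    constructor
    · rintro ⟨u, ⟨_, _, hu⟩, rfl⟩
      exact hu
    · intro hx
      have : x ∈ Finset.range (cntBelow B n) := Finset.mem_range.mpr (by omega)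
      rw [← himg] at this
      simp only [Finset.mem_image, Finset.mem_filter, Finset.mem_range] at this
      obtain ⟨u, ⟨hu, hBu⟩, rfl⟩ := this
      exact ⟨u, ⟨hu, hBu, hx⟩, rfl⟩
  rw [Nat.count_eq_card_filter_range, ← Finset.card_image_of_injOn (f := insertPos B r n), this,
    Finset.card_range]
  intro u hu v hv h
  simp only [Finset.coe_filter, Finset.mem_range, Set.mem_ofPred_eq] at hu hv
  exact insertPos_injOn r n u hu.1 v hv.1 hu.2.1 hv.2.1 h

theorem cntBefore_insertPos (r : ℕ → ℕ) (hr : ∀ v, r v ≤ cntBelow B v) (n : ℕ) :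
    ∀ v < n, B v → cntBefore B (insertPos B r n) v = r v := by
  induction n with
  | zero => simp
  | succ n ih =>
    intro v hv hBv
    rcases (Nat.lt_succ_iff_lt_or_eq.mp hv) with hv | rfl
    · rw [← ih v hv hBv, cntBefore, cntBefore, Nat.count_eq_card_filter_range,
        Nat.count_eq_card_filter_range]
      congr 1
      refine Finset.filter_congr fun u hu => ?_
      rw [insertPos_succ_lt_iff r ((Finset.mem_range.mp hu).trans hv) hv]
    -- When `v` is inserted at rank `r v`, the elements at positions below `r v` stay there and all
    -- others move beyond it. By gaplessness the former number exactly `r v`.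
    · conv_rhs => rw [← count_insertPos_lt r hr v (r v) (hr v)]
      rw [cntBefore, Nat.count_eq_card_filter_range, Nat.count_eq_card_filter_range]
      congr 1
      refine Finset.filter_congr fun u hu => ?_
      have hu := Finset.mem_range.mp hu
      simp only [insertPos, if_pos hBv, if_neg hu.ne, if_true]
      refine and_congr_right fun _ => ?_
      split_ifs <;> omega

/-- A linear order is determined by the numbers of smaller elements that precede each element. -/
theorem lt_iff_lt_of_cntBefore_eq {p q : ℕ → ℕ} (n : ℕ)
    (hp : ∀ u < n, ∀ v < n, S u → S v → p u = p v → u = v)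
    (hq : ∀ u < n, ∀ v < n, S u → S v → q u = q v → u = v)
    (h : ∀ v < n, S v → cntBefore S p v = cntBefore S q v) :
    ∀ u < n, ∀ v < n, S u → S v → (p u < p v ↔ q u < q v) := by
  have main : ∀ (p q : ℕ → ℕ) (v : ℕ),
      (∀ u < v, ∀ w < v, S u → S w → (p u < p w ↔ q u < q w)) →
      (∀ u < v, S u → q v ≠ q u) →
      cntBefore S p v = cntBefore S q v → ∀ u < v, S u → p u < p v → q u < q v := by
    intro p q v ih hne hc u hu hSu hlt
    by_contra hnot
    have hnot : q v < q u := lt_of_le_of_ne (not_lt.mp hnot) (hne u hu hSu)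
    -- Suppose `u` precedes `v` for `p` but not for `q`. Any `w` with `q w < q v < q u` has `p w < p
    -- u < p v` by the induction hypothesis, so the predecessors of `v` under `q` are a proper
    -- subset of those under `p`: `u` is missing. The counts would differ.
    simp only [cntBefore, Nat.count_eq_card_filter_range] at hc
    refine absurd hc (ne_of_gt (Finset.card_lt_card ?_))
    rw [Finset.ssubset_iff_of_subset]
    · refine ⟨u, by simp [hu, hSu, hlt], by simp only [Finset.mem_filter]; omega⟩
    · intro w hw
      simp only [Finset.mem_filter, Finset.mem_range] at hw ⊢
      refine ⟨hw.1, hw.2.1, lt_trans ?_ hlt⟩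
      rw [ih w hw.1 u hu hw.2.1 hSu]
      omega
  have step : ∀ v < n, S v → (∀ u < v, ∀ w < v, S u → S w → (p u < p w ↔ q u < q w)) →
      ∀ u < v, S u → (p u < p v ↔ q u < q v) := by
    intro v hv hSv ih u hu hSu
    refine ⟨main p q v ih ?_ (h v hv hSv) u hu hSu,
      main q p v (fun u hu w hw h₁ h₂ => (ih u hu w hw h₁ h₂).symm) ?_ (h v hv hSv).symm u hu hSu⟩
    · intro w hw hSw he
      exact hw.ne (hq v hv w (hw.trans hv) hSv hSw he).symm
    · intro w hw hSw he
      exact hw.ne (hp v hv w (hw.trans hv) hSv hSw he).symm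
  have all : ∀ m ≤ n, ∀ u < m, ∀ w < m, S u → S w → (p u < p w ↔ q u < q w) := by
    intro m
    induction m with
    | zero => simp
    | succ m ih =>
      intro hm u hu w hw hSu hSw
      have ih := ih (by omega)
      rcases (Nat.lt_succ_iff_lt_or_eq.mp hu) with hu | rfl <;>
        rcases (Nat.lt_succ_iff_lt_or_eq.mp hw) with hw | rfl
      · exact ih u hu w hw hSu hSw
      · exact step w (by omega) hSw ih u hu hSu
      · have h₁ := step u (by omega) hSu ih w hw hSw
        have h₂ : p u ≠ p w := fun he => hw.ne' (hp u (by omega) w (by omega) hSu hSw he)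
        have h₃ : q u ≠ q w := fun he => hw.ne' (hq u (by omega) w (by omega) hSu hSw he)
        omega
      · simp
  exact all n le_rfl

/-! #### Encoding -/

theorem codeOf_lt (c p : ℕ → ℕ) (n : ℕ) (hc : ∀ v < n, S v → c v < k) :
    codeOf S k c p n < codeCard S k n := by
  induction n with
  | zero => simp [codeOf]
  | succ n ih =>
    have ih := ih fun v hv => hc v (by omega)
    rw [codeOf, codeCard_succ]
    split_ifs with hS
    · have h₁ : c n * (cntBelow S n + 1) + cntBefore S p n < k * (cntBelow S n + 1) := by
        have := cntBefore_le S p n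
        calc _ < c n * (cntBelow S n + 1) + (cntBelow S n + 1) := by omega
          _ = (c n + 1) * (cntBelow S n + 1) := by ring
          _ ≤ _ := Nat.mul_le_mul_right _ (hc n (by omega) hS)
      calc _ < codeOf S k c p n * (k * (cntBelow S n + 1)) + k * (cntBelow S n + 1) := by omega
        _ = (codeOf S k c p n + 1) * (k * (cntBelow S n + 1)) := by ring
        _ ≤ _ := Nat.mul_le_mul_right _ ih
    · exact ih

theorem cntBefore_congr {p q : ℕ → ℕ} {v : ℕ}
    (h : ∀ u < v, S u → (p u < p v ↔ q u < q v)) : cntBefore S p v = cntBefore S q v := by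
  rw [cntBefore, cntBefore, Nat.count_eq_card_filter_range, Nat.count_eq_card_filter_range]
  congr 1
  refine Finset.filter_congr fun u hu => and_congr_right fun hS => ?_
  exact h u (Finset.mem_range.mp hu) hS

theorem codeOf_congr {c d p q : ℕ → ℕ} (n : ℕ) (hc : ∀ v < n, S v → c v = d v)
    (hp : ∀ u < n, ∀ v < n, S u → S v → (p u < p v ↔ q u < q v)) :
    codeOf S k c p n = codeOf S k d q n := by
  induction n with
  | zero => rfl
  | succ n ih =>
    rw [codeOf, codeOf, ih (fun v hv => hc v (by omega))
      (fun u hu v hv => hp u (by omega) v (by omega))]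
    split_ifs with hS
    · rw [hc n (by omega) hS, cntBefore_congr fun u hu hSu => hp u (by omega) n (by omega) hSu hS]
    · rfl

/-- Horner's scheme with every digit below its radix: the last digit is the remainder, the rest the
quotient. Unlike a state, a key is never decoded, so injectivity is all that is required of it. -/
theorem codeOf_inj {c d p q : ℕ → ℕ} (n : ℕ) (hc : ∀ v < n, S v → c v < k)
    (hd : ∀ v < n, S v → d v < k) (h : codeOf S k c p n = codeOf S k d q n) :
    ∀ v < n, S v → c v = d v ∧ cntBefore S p v = cntBefore S q v := by
  have split : ∀ a b a' b' m : ℕ, b < m → b' < m → a * m + b = a' * m + b' → a = a' ∧ b = b' := by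
    intro a b a' b' m hb hb' h
    have h₁ := congrArg (· / m) h
    have h₂ := congrArg (· % m) h
    simp only [Nat.mul_add_mod_self_right, Nat.mod_eq_of_lt hb, Nat.mod_eq_of_lt hb'] at h₂
    subst h₂
    exact ⟨Nat.eq_of_mul_eq_mul_right (by omega) (Nat.add_right_cancel h), rfl⟩
  induction n with
  | zero => simp
  | succ n ih =>
    intro v hv hSv
    rw [codeOf, codeOf] at h
    have ih := ih (fun v hv => hc v (by omega)) (fun v hv => hd v (by omega))
    split_ifs at h with hS
    · have lt : ∀ (c : ℕ → ℕ) (p : ℕ → ℕ), c n < k →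
          c n * (cntBelow S n + 1) + cntBefore S p n < k * (cntBelow S n + 1) := by
        intro c p hc
        have := cntBefore_le S p n
        calc _ < c n * (cntBelow S n + 1) + (cntBelow S n + 1) := by omega
          _ = (c n + 1) * (cntBelow S n + 1) := by ring
          _ ≤ _ := Nat.mul_le_mul_right _ hc
      obtain ⟨h₁, h₂⟩ := split _ _ _ _ _ (lt c p (hc n (by omega) hS))
        (lt d q (hd n (by omega) hS)) h
      rcases (Nat.lt_succ_iff_lt_or_eq.mp hv) with hv | rfl
      · exact ih h₁ v hv hSv
      · exact split _ _ _ _ _ (Nat.lt_succ_of_le (cntBefore_le S p v))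
          (Nat.lt_succ_of_le (cntBefore_le S q v)) h₂
    · rcases (Nat.lt_succ_iff_lt_or_eq.mp hv) with hv | rfl
      exacts [ih h v hv hSv, absurd hSv hS]

/-- The positions of the elements of `B` below `n` according to the code `σ`. -/
noncomputable def codePos (B : ℕ → Prop) (k n σ : ℕ) : ℕ → ℕ :=
  insertPos B (codeRank B k σ) n

theorem codePos_injOn (B : ℕ → Prop) (k n σ : ℕ) :
    ∀ u < n, ∀ v < n, B u → B v → codePos B k n σ u = codePos B k n σ v → u = v :=
  insertPos_injOn _ n

theorem exists_code (B : ℕ → Prop) (n : ℕ) (c p : ℕ → ℕ) (hk : 1 ≤ k) (hc : ∀ v, c v < k)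
    (hp : ∀ u < n, ∀ v < n, B u → B v → p u = p v → u = v) :
    ∃ σ < codeCard B k n, (∀ v < n, B v → codeCol B k σ v = c v) ∧
      ∀ u < n, ∀ v < n, B u → B v → (codePos B k n σ u < codePos B k n σ v ↔ p u < p v) := by
  obtain ⟨σ, hσ, h⟩ := exists_code_of_digits (B := B) hk
    (fun v => c v * (cntBelow B v + 1) + cntBefore B p v) (fun v => by
      have := cntBefore_le B p v
      calc _ < c v * (cntBelow B v + 1) + (cntBelow B v + 1) := by omega
        _ = (c v + 1) * (cntBelow B v + 1) := by ring
        _ ≤ _ := Nat.mul_le_mul_right _ (hc v)) n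
  refine ⟨σ, hσ, fun v hv hBv => ?_, ?_⟩
  · rw [codeCol, h v hv hBv, mul_comm, Nat.mul_add_div (Nat.succ_pos _),
      Nat.div_eq_of_lt (Nat.lt_succ_of_le (cntBefore_le B p v)), add_zero]
  · refine lt_iff_lt_of_cntBefore_eq n (codePos_injOn B k n σ) hp fun v hv hBv => ?_
    rw [codePos, cntBefore_insertPos _ (codeRank_le B k σ) n v hv hBv, codeRank, h v hv hBv,
      Nat.mul_add_mod_self_right, Nat.mod_eq_of_lt (Nat.lt_succ_of_le (cntBefore_le B p v))]

end Codes

/-! ### The program -/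

/-- The input of the algorithm as it lies in the memory: the numbers of vertices, of nodes and of
colors, and the three arrays. -/
structure RawInput where
  n : ℕ
  N : ℕ
  k : ℕ
  adj : ℕ → ℕ
  tree : ℕ → ℕ
  inc : ℕ → ℕ

namespace RawInput

variable (I : RawInput)

/-- There is an arc from `u` to `v`. -/
def Arc (u v : ℕ) : Prop := I.adj (u * I.n + v) ≠ 0

/-- The nodes `t` and `t'` are adjacent. -/
def Edge (t t' : ℕ) : Prop := I.tree (t * I.N + t') ≠ 0

/-- The vertex `v` lies in the bag of `t`. -/
def Bag (t v : ℕ) : Prop := I.inc (t * I.n + v) ≠ 0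

/-- The vertex `v` lies in the bags of `t` and `t'`. -/
def Common (t t' v : ℕ) : Prop := I.Bag t v ∧ I.Bag t' v

/-- The number of states of the node `t`. -/
noncomputable def states (t : ℕ) : ℕ := codeCard (I.Bag t) I.k I.n

/-- The color of the vertex `v` in the state `σ` of the node `t`. -/
noncomputable def col (t σ v : ℕ) : ℕ := codeCol (I.Bag t) I.k σ v

/-- The position of the vertex `v` in the state `σ` of the node `t`. -/
noncomputable def pos (t σ v : ℕ) : ℕ := codePos (I.Bag t) I.k I.n σ v

/-- The code of the restriction of the state `σ` of `t` to the common vertices of `t` and `t'`. -/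
noncomputable def key (t t' σ : ℕ) : ℕ := codeOf (I.Common t t') I.k (I.col t σ) (I.pos t σ) I.n

/-- All arcs in the bag whose ends have the same color point forward. -/
def Valid (t σ : ℕ) : Prop :=
  ∀ u < I.n, ∀ v < I.n, I.Arc u v → I.Bag t u → I.Bag t v → I.col t σ u = I.col t σ v →
    I.pos t σ u < I.pos t σ v

/-- The state `σ` of the node `t` survives `r` rounds: it is valid, and each neighbor of `t` has a
state that survives `r - 1` rounds and agrees with `σ` on the common vertices. -/
def Alive : ℕ → ℕ → ℕ → Prop
  | 0, t, σ => I.Valid t σ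
  | r + 1, t, σ => I.Valid t σ ∧ ∀ t' < I.N, I.Edge t t' →
      ∃ σ' < I.states t', Alive r t' σ' ∧ I.key t' t σ' = I.key t t' σ

end RawInput

namespace WordRAM

/-- The memory holds the input. -/
structure Mem.Holds (s : Mem) (I : RawInput) : Prop where
  n : s.var 0 = I.n
  N : s.var 1 = I.N
  k : s.var 2 = I.k
  adj : s.arr 0 = I.adj
  tree : s.arr 1 = I.tree
  inc : s.arr 2 = I.inc

/-- The program does not write to the input. -/
def Prog.keepsInput (p : Prog) : Bool :=
  !p.writesVar 0 && !p.writesVar 1 && !p.writesVar 2 &&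
    !p.writesArr 0 && !p.writesArr 1 && !p.writesArr 2

theorem Mem.Holds.frame {s s' : Mem} {I : RawInput} {p : Prog} (h : s.Holds I)
    (hF : Frame p s s') (hp : p.keepsInput = true) : s'.Holds I := by
  simp only [Prog.keepsInput, Bool.and_eq_true, Bool.not_eq_true'] at hp
  obtain ⟨⟨⟨⟨⟨h0, h1⟩, h2⟩, h3⟩, h4⟩, h5⟩ := hp
  exact ⟨(hF.1 _ h0).trans h.n, (hF.1 _ h1).trans h.N, (hF.1 _ h2).trans h.k,
    (hF.2 _ h3).trans h.adj, (hF.2 _ h4).trans h.tree, (hF.2 _ h5).trans h.inc⟩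

/-- Whether the vertex in the variable `v` lies in the bag of the node in the variable `t`. -/
def bagE (t v : ℕ) : Expr := .get 2 (.add (.mul (.var t) (.var 0)) (.var v))

/-- Whether the vertex in the variable `v` lies in the bags of the nodes in the variables `4` and
`10`. -/
def bothE (v : ℕ) : Expr := .mul (bagE 4 v) (bagE 10 v)

/-- Insert an element at the rank in variable `13`: shift the later positions by one. -/
def insertP : Prog :=
  forLoop 9 8 (.ite (.mul (bagE 4 9) (.sub (.add (.get 4 (.var 9)) (.lit 1)) (.var 13)))
    (.put 4 (.var 9) (.add (.get 4 (.var 9)) (.lit 1))) .skip)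

/-- Decode the color and the position of the vertex in variable `8`. -/
def decodeStepP : Prog :=
  .seq (.set 11 (.add (.var 11) (.lit 1)))
  (.seq (.set 12 (.mul (.var 2) (.var 11)))
  (.seq (.set 13 (.div (.var 5) (.var 16)))
  (.seq (.set 13 (.sub (.var 13) (.mul (.div (.var 13) (.var 12)) (.var 12))))
  (.seq (.put 3 (.var 8) (.div (.var 13) (.var 11)))
  (.seq (.set 13 (.sub (.var 13) (.mul (.div (.var 13) (.var 11)) (.var 11))))
  (.seq (.set 16 (.mul (.var 16) (.var 12)))
  (.seq insertP
  (.put 4 (.var 8) (.var 13)))))))))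

/-- Decode the state in variable `5` of the node in variable `4` into the colors in array `3` and
the positions in array `4`; the number of states is put into variable `16`. -/
def decodeP : Prog :=
  .seq (.set 11 (.lit 0)) (.seq (.set 16 (.lit 1))
    (forLoop 8 0 (.ite (bagE 4 8) decodeStepP .skip)))

/-- Put into variable `17` the number of smaller common vertices that precede the vertex in
variable `8`. -/
def countP : Prog :=
  .seq (.set 17 (.lit 0))
    (forLoop 9 8 (.ite (.mul (bothE 9) (.sub (.get 4 (.var 8)) (.get 4 (.var 9))))
      (.set 17 (.add (.var 17) (.lit 1))) .skip))

/-- Append the digit of the vertex in variable `8` to the code in variable `15`. -/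
def keyStepP : Prog :=
  .seq (.set 11 (.add (.var 11) (.lit 1)))
  (.seq countP
  (.set 15 (.add (.mul (.var 15) (.mul (.var 2) (.var 11)))
    (.add (.mul (.get 3 (.var 8)) (.var 11)) (.var 17)))))

/-- Put into variable `15` the code of the restriction of the decoded state to the common vertices
of the nodes in the variables `4` and `10`. -/
def keyP : Prog :=
  .seq (.set 15 (.lit 0)) (.seq (.set 11 (.lit 0))
    (forLoop 8 0 (.ite (bothE 8) keyStepP .skip)))

/-- Whether there is an arc from the vertex in variable `8` to the vertex in variable `9`, both in
the bag, of the same color, and the second does not come after the first. -/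
def conflictE : Expr :=
  .mul (.mul (.get 0 (.add (.mul (.var 8) (.var 0)) (.var 9))) (.mul (bagE 4 8) (bagE 4 9)))
    (.mul (.sub (.sub (.lit 1) (.sub (.get 3 (.var 8)) (.get 3 (.var 9))))
        (.sub (.get 3 (.var 9)) (.get 3 (.var 8))))
      (.sub (.add (.get 4 (.var 8)) (.lit 1)) (.get 4 (.var 9))))

/-- Put into variable `14` whether the decoded state is valid. -/
def validP : Prog :=
  .seq (.set 14 (.lit 1))
    (forLoop 8 0 (forLoop 9 0 (.ite conflictE (.set 14 (.lit 0)) .skip)))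

/-- The index of the table entry for the code in variable `15`, the layer `r`, the receiver in
variable `t` and the sender in variable `t'`. -/
def indexE (r : Expr) (t t' : ℕ) : Expr :=
  .add (.mul (.add (.mul (.add (.mul (.var 15) (.add (.var 1) (.lit 2))) r) (.var 1)) (.var t))
    (.var 1)) (.var t')

/-- Clear variable `14` unless each neighbor has sent, in the previous round, the code of the
restriction of the decoded state. -/
def receiveP : Prog :=
  forLoop 10 1 (.ite (.get 1 (.add (.mul (.var 4) (.var 1)) (.var 10)))
    (.seq keyP (.ite (.add (.get 5 (indexE (.var 3) 4 10)) (.sub (.lit 1) (.var 3)))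
      .skip (.set 14 (.lit 0)))) .skip)

/-- Send the codes of the restrictions of the decoded state. -/
def sendP : Prog :=
  forLoop 10 1 (.seq keyP (.put 5 (indexE (.add (.var 3) (.lit 1)) 10 4) (.lit 1)))

/-- Process the state in variable `5` of the node in variable `4` in the round in variable `3`. -/
def stateP : Prog :=
  .seq decodeP (.seq validP (.seq receiveP
    (.ite (.var 14) (.seq (.set 7 (.lit 1)) sendP) .skip)))

/-- Process all states of the node in variable `4`; variable `7` tells whether one survives. -/
def nodeP : Prog :=
  .seq (.set 5 (.lit 0)) (.seq decodeP (.seq (.set 6 (.var 16)) (.seq (.set 7 (.lit 0))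
    (forLoop 5 6 stateP))))

/-- Run all rounds. -/
def roundsP : Prog :=
  .seq (.set 18 (.add (.var 1) (.lit 1))) (forLoop 3 18 (forLoop 4 1 nodeP))

/-- The decision algorithm. -/
def mainP : Prog :=
  .seq (.ite (.sub (.var 0) (.var 2)) roundsP (.set 7 (.lit 1))) (.set 0 (.var 7))

/-! ### Verification of decoding, restriction and validity. -/

variable {I : RawInput} {Z : ℕ} {s : Mem}

theorem Mem.Holds.eval_bagE (hI : s.Holds I) (t v : ℕ) :
    (bagE t v).eval s = I.inc (s.var t * I.n + s.var v) := by
  simp [bagE, Expr.eval, hI.n, hI.inc]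

theorem Mem.Holds.eval_bothE (hI : s.Holds I) (v : ℕ) :
    (bothE v).eval s = I.inc (s.var 4 * I.n + s.var v) * I.inc (s.var 10 * I.n + s.var v) := by
  simp [bothE, Expr.eval, hI.eval_bagE]

open Classical in
theorem insert_spec (hI : s.Holds I) {t v ρ : ℕ} (ht : s.var 4 = t) (hv : s.var 8 = v)
    (hρ : s.var 13 = ρ) (hb : ∀ u < v, I.Bag t u → s.arr 4 u + 1 ≤ Z) :
    Spec Z insertP s (50 * v + 6) fun s' => ∀ u < v, s'.arr 4 u =
      if I.Bag t u ∧ ρ ≤ s.arr 4 u then s.arr 4 u + 1 else s.arr 4 u := by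
  refine Spec.le ((Spec.forLoop (m := v) (T := 40) (by decide) rfl rfl hv
    (fun i s' => ∀ u, s'.arr 4 u =
      if u < i ∧ I.Bag t u ∧ ρ ≤ s.arr 4 u then s.arr 4 u + 1 else s.arr 4 u) ?_ ?_).imp ?_) (by omega)
  · simp
  · intro i hi s' hs' hF h9 h8 hinv
    have hI' := hI.frame hF rfl
    have h4 := (hF.var 4 rfl).trans ht
    have h13 := (hF.var 13 rfl).trans hρ
    have hi4 : s'.arr 4 i = s.arr 4 i := by simp [hinv]
    have heval : Expr.eval s' (.mul (bagE 4 9)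
        (.sub (.add (.get 4 (.var 9)) (.lit 1)) (.var 13))) ≠ 0 ↔ I.Bag t i ∧ ρ ≤ s.arr 4 i := by
      simp only [Expr.eval, hI'.eval_bagE, h4, h9, h13, hi4, RawInput.Bag, mul_ne_zero_iff]
      omega
    refine Spec.le (Spec.ite (T := 10) rfl (fun h =>
      Spec.le (Spec.put (i := i) (m := s.arr 4 i + 1) rfl rfl
      (by simp [Expr.eval, h9]) (by simp [Expr.eval, h9, hi4]) ?_ ?_) (by decide))
      (fun h => Spec.le (Spec.skip ?_) (by decide))) (by decide)
    · rw [heval] at h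
      exact hb i hi h.1
    · rw [heval] at h
      intro u
      simp only [Mem.setVar_arr, Mem.setArr_arr, true_and, hinv]
      by_cases hu : u = i
      · subst hu; simp [h]
      · have : u < i + 1 ↔ u < i := by omega
        simp [hu, this]
    · have h : ¬ (I.Bag t i ∧ ρ ≤ s.arr 4 i) := by rw [← heval]; simpa using h
      intro u
      simp only [Mem.setVar_arr, hinv]
      by_cases hu : u = i
      · subst hu; simp only [h, and_false]
      · have : u < i + 1 ↔ u < i := by omega
        simp only [this]
  · intro s' _ _ h u hu
    simp [h.1 u, hu]

end WordRAM

/-- The bounds on the quantities that occur in the computation. -/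
structure RawInput.BddBy (I : RawInput) (Z : ℕ) : Prop where
  one_le_k : 1 ≤ I.k
  mul_le : I.k * I.n ≤ Z
  states_le : ∀ t < I.N, I.states t ≤ Z

theorem RawInput.BddBy.n_le {I : RawInput} {Z : ℕ} (h : I.BddBy Z) : I.n ≤ Z :=
  (Nat.le_mul_of_pos_left _ h.one_le_k).trans h.mul_le

theorem RawInput.BddBy.codeCard_le {I : RawInput} {Z : ℕ} (h : I.BddBy Z) {t v : ℕ} (ht : t < I.N)
    (hv : v ≤ I.n) : codeCard (I.Bag t) I.k v ≤ Z :=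
  (codeCard_mono _ h.one_le_k hv).trans (h.states_le t ht)

namespace WordRAM
variable {I : RawInput} {Z : ℕ} {s : Mem}

/-- Variable `16` carries the place value of the current digit, `11` the number of bag vertices so
far and `12` the radix. The radix is at most k·n and the place value at most the number of states,
which keeps all cells below `Z`. -/
theorem decodeStep_spec (hI : s.Holds I) (hZ : I.BddBy Z) {t σ v : ℕ} (htN : t < I.N)
    (ht : s.var 4 = t) (hσ : s.var 5 = σ) (hv : s.var 8 = v) (hvn : v < I.n) (hB : I.Bag t v)
    (h11 : s.var 11 = cntBelow (I.Bag t) v) (h16 : s.var 16 = codeCard (I.Bag t) I.k v)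
    (h3 : ∀ u < v, I.Bag t u → s.arr 3 u = I.col t σ u)
    (h4 : ∀ u < v, I.Bag t u →
      s.arr 4 u = insertPos (I.Bag t) (codeRank (I.Bag t) I.k σ) v u) :
    Spec Z decodeStepP s (50 * v + 60) fun s' =>
      s'.var 11 = cntBelow (I.Bag t) (v + 1) ∧ s'.var 16 = codeCard (I.Bag t) I.k (v + 1) ∧
      (∀ u < v + 1, I.Bag t u → s'.arr 3 u = I.col t σ u) ∧
      ∀ u < v + 1, I.Bag t u →
        s'.arr 4 u = insertPos (I.Bag t) (codeRank (I.Bag t) I.k σ) (v + 1) u := by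
  refine Spec.of_bdd fun hs => ?_
  have hcnt := cntBelow_le (I.Bag t) v
  have hm : I.k * (cntBelow (I.Bag t) v + 1) ≤ Z :=
    (Nat.mul_le_mul_left _ (by omega)).trans hZ.mul_le
  have hσZ : σ ≤ Z := hσ ▸ hs.var_le 5
  -- The instruction set has no remainder; it is computed by division, multiplication and
  -- subtraction.
  have hmod : ∀ a b : ℕ, a - a / b * b = a % b := fun a b => by
    rw [Nat.mod_eq_sub_mul_div, mul_comm]
  have hcard : codeCard (I.Bag t) I.k v * (I.k * (cntBelow (I.Bag t) v + 1)) =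
      codeCard (I.Bag t) I.k (v + 1) := by rw [codeCard_succ, if_pos hB]
  set m := cntBelow (I.Bag t) v + 1 with hmdef
  have hdig : codeDigit (I.Bag t) I.k σ v = σ / codeCard (I.Bag t) I.k v % (I.k * m) := rfl
  have hcol : I.col t σ v = codeDigit (I.Bag t) I.k σ v / m := rfl
  have hrank : codeRank (I.Bag t) I.k σ v = codeDigit (I.Bag t) I.k σ v % m := rfl
  have hdigZ : codeDigit (I.Bag t) I.k σ v ≤ Z := (codeDigit_lt _ hZ.one_le_k _ _).le.trans hm
  have hrankZ : codeRank (I.Bag t) I.k σ v ≤ Z := (Nat.mod_le _ _).trans hdigZ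
  set d := codeDigit (I.Bag t) I.k σ v with hd
  refine Spec.le (Spec.set_seq m rfl (by simp [Expr.eval, h11, hmdef]) ?_ <|
    Spec.set_seq (I.k * m) rfl (by simp [Expr.eval, hI.k]) hm <|
    Spec.set_seq (σ / codeCard (I.Bag t) I.k v) rfl (by simp [Expr.eval, hσ, h16])
      ((Nat.div_le_self _ _).trans hσZ) <|
    Spec.set_seq d rfl (by simp [Expr.eval, hmod, hdig]) hdigZ <|
    Spec.put_seq v (I.col t σ v) rfl rfl (by simp [Expr.eval, hv]) (by simp [Expr.eval, hcol])
      (hcol ▸ (Nat.div_le_self _ _).trans hdigZ) <|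
    Spec.set_seq (codeRank (I.Bag t) I.k σ v) rfl (by simp [Expr.eval, hmod, hrank]) hrankZ <|
    Spec.set_seq (codeCard (I.Bag t) I.k (v + 1)) rfl (by simp [Expr.eval, h16, hcard])
      (hZ.codeCard_le htN hvn) <|
    Spec.seq (insert_spec (I := I) (t := t) (v := v) (ρ := codeRank (I.Bag t) I.k σ v)
      ?_ ?_ ?_ ?_ ?_) ?_ (T₂ := 3)) ?_
  · have := hZ.n_le
    omega
  · constructor <;> try funext i
    all_goals simp [hI.n, hI.N, hI.k, hI.adj, hI.tree, hI.inc]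
  · simp [ht]
  · simp [hv]
  · simp
  · intro u hu hBu
    have h₁ := insertPos_lt (codeRank (I.Bag t) I.k σ) (codeRank_le (I.Bag t) I.k σ) v u hu hBu
    have := hZ.n_le
    simp only [Mem.setVar_arr, Mem.setArr_arr, h4 u hu hBu]
    rw [if_neg (by omega)]
    omega
  · intro s' hs' hF hins
    have h8 := hF.var 8 rfl
    have h11' := hF.var 11 rfl
    have h13 := hF.var 13 rfl
    have h16' := hF.var 16 rfl
    have h3' := fun u => congrFun (hF.arr 3 rfl) u
    simp [hv] at h8 h11' h13 h16' h3' hins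
    refine Spec.put (i := v) (m := codeRank (I.Bag t) I.k σ v) rfl rfl (by simp [Expr.eval, h8])
      (by simp [Expr.eval, h13]) hrankZ ⟨?_, ?_, ?_, ?_⟩
    · simp [h11', cntBelow_succ, hB, hmdef]
    · simp [h16']
    · intro u hu hBu
      simp only [Mem.setArr_arr, h3']
      by_cases huv : u = v
      · simp [huv]
      · simpa [huv] using h3 u (by omega) hBu
    · intro u hu hBu
      simp only [Mem.setArr_arr, true_and, insertPos, if_pos hB]
      by_cases huv : u = v
      · simp [huv]
      · rw [if_neg huv, if_neg huv, hins u (by omega), h4 u (by omega) hBu]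
        simp [hBu, h4 u (by omega) hBu]
  · simp [Expr.cost]
    omega

theorem decode_spec (hI : s.Holds I) (hZ : I.BddBy Z) {t σ : ℕ} (htN : t < I.N)
    (ht : s.var 4 = t) (hσ : s.var 5 = σ) :
    Spec Z decodeP s (100 * (I.n + 1) ^ 2) fun s' => s'.var 16 = I.states t ∧
      ∀ v < I.n, I.Bag t v → s'.arr 3 v = I.col t σ v ∧ s'.arr 4 v = I.pos t σ v := by
  refine Spec.of_bdd fun hs => ?_
  refine Spec.le (Spec.set_seq 0 rfl rfl (by simp) <| Spec.set_seq 1 rfl rfl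
    (by have := hs.two_le; omega) <|
    (Spec.forLoop (m := I.n) (T := 50 * I.n + 80) (by decide) rfl rfl (by simp [hI.n])
      (fun v s' =>
        s'.var 11 = cntBelow (I.Bag t) v ∧ s'.var 16 = codeCard (I.Bag t) I.k v ∧
        (∀ u < v, I.Bag t u → s'.arr 3 u = I.col t σ u) ∧
        ∀ u < v, I.Bag t u →
          s'.arr 4 u = insertPos (I.Bag t) (codeRank (I.Bag t) I.k σ) v u)
      (by simp) ?_).imp ?_) ?_
  · intro v hv s' hs' hF h8 _ ⟨h11, h16, h3, h4⟩
    have hI' : s'.Holds I := by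
      refine Mem.Holds.frame ?_ hF rfl
      constructor <;> try funext i
      all_goals simp [hI.n, hI.N, hI.k, hI.adj, hI.tree, hI.inc]
    have ht' : s'.var 4 = t := by rw [hF.var 4 rfl]; simp [ht]
    have hσ' : s'.var 5 = σ := by rw [hF.var 5 rfl]; simp [hσ]
    have hb : (bagE 4 8).eval s' = I.inc (t * I.n + v) := by rw [hI'.eval_bagE, ht', h8]
    refine Spec.le (Spec.ite (T := 50 * I.n + 70) rfl (fun h => ?_) fun h => ?_) ?_
    · refine ((decodeStep_spec hI' hZ htN ht' hσ' h8 hv (by rwa [hb] at h) h11 h16 h3 h4).le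
        (by omega)).imp ?_
      simp
    · have hB : ¬ I.Bag t v := by simpa [RawInput.Bag, hb] using h
      refine (Spec.skip ⟨?_, ?_, ?_, ?_⟩).le (by omega)
      · simp [cntBelow_succ, hB, h11]
      · simp [codeCard_succ, hB, h16]
      · intro u hu hBu
        have : u ≠ v := fun h => hB (h ▸ hBu)
        simpa using h3 u (by omega) hBu
      · intro u hu hBu
        have : u ≠ v := fun h => hB (h ▸ hBu)
        simpa [insertPos, hB] using h4 u (by omega) hBu
    · simp [bagE, Expr.cost]
      omega
  · rintro s' _ _ ⟨⟨_, h16, h3, h4⟩, _⟩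
    exact ⟨h16, fun v hv hBv => ⟨h3 v hv hBv, h4 v hv hBv⟩⟩
  · simp only [Expr.cost]
    nlinarith

theorem Mem.Holds.eval_bothE_ne_zero (hI : s.Holds I) {t t' v x : ℕ} (ht : s.var 4 = t)
    (ht' : s.var 10 = t') (hx : s.var x = v) : (bothE x).eval s ≠ 0 ↔ I.Common t t' v := by
  rw [hI.eval_bothE, ht, ht', hx, mul_ne_zero_iff, RawInput.Common, RawInput.Bag, RawInput.Bag]

theorem count_spec (hI : s.Holds I) {t t' v : ℕ} {p : ℕ → ℕ} (ht : s.var 4 = t)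
    (ht' : s.var 10 = t') (hv : s.var 8 = v) (hp : ∀ u ≤ v, I.Common t t' u → s.arr 4 u = p u)
    (hC : I.Common t t' v) :
    Spec Z countP s (60 * v + 10) fun s' => s'.var 17 = cntBefore (I.Common t t') p v := by
  classical
  refine Spec.of_bdd fun hs => ?_
  refine Spec.le (Spec.set_seq 0 rfl rfl (by simp) <|
    (Spec.forLoop (m := v) (T := 40) (by decide) rfl rfl (by simp [hv])
      (fun i s' => s'.var 17 = Nat.count (fun u => I.Common t t' u ∧ p u < p v) i)
      (by simp) ?_).imp ?_) ?_
  · intro i hi s' hs' hF h9 h8 h17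
    have hI' : s'.Holds I := by
      refine Mem.Holds.frame ?_ hF rfl
      constructor <;> try funext i
      all_goals simp [hI.n, hI.N, hI.k, hI.adj, hI.tree, hI.inc]
    have h4 : s'.var 4 = t := by rw [hF.var 4 rfl]; simp [ht]
    have h10 : s'.var 10 = t' := by rw [hF.var 10 rfl]; simp [ht']
    have ha : s'.arr 4 = s.arr 4 := hF.arr 4 rfl
    have heval : Expr.eval s' (.mul (bothE 9) (.sub (.get 4 (.var 8)) (.get 4 (.var 9)))) ≠ 0 ↔
        I.Common t t' i ∧ p i < p v := by
      rw [Expr.eval, mul_ne_zero_iff, hI'.eval_bothE_ne_zero h4 h10 h9]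
      refine and_congr_right fun hCi => ?_
      simp only [Expr.eval, h8, h9, ha, hp v le_rfl hC, hp i hi.le hCi]
      omega
    have hcount : Nat.count (fun u => I.Common t t' u ∧ p u < p v) (i + 1) ≤ Z :=
      le_trans (Nat.count_le _) ((by omega : i + 1 ≤ v).trans (hv ▸ hs.var_le 8))
    refine Spec.le (Spec.ite (T := 10) rfl (fun h => ?_) fun h => ?_) (by decide)
    · refine (Spec.set rfl rfl ?_ ?_).le (by decide)
      · rw [heval] at h
        simpa [Expr.eval, h17, Nat.count_succ, h] using hcount
      · rw [heval] at h
        simp [Expr.eval, h17, Nat.count_succ, h]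
    · refine (Spec.skip ?_).le (by decide)
      have h := (not_congr heval).mp (by simpa using h)
      simp [h17, Nat.count_succ, h]
  · intro s' _ _ h
    rw [h.1, cntBefore]
  · simp only [Expr.cost]
    omega

/-- A restriction to fewer vertices has no more codes than the full bag, so keys are as small as
states. -/
theorem _root_.RawInput.BddBy.common_le (hZ : I.BddBy Z) {t : ℕ} (t' : ℕ) (ht : t < I.N) {v : ℕ}
    (hv : v ≤ I.n) : codeCard (I.Common t t') I.k v ≤ Z :=
  (_root_.codeCard_le hZ.one_le_k ((cntBelow_mono_set (fun _ h => h.1) v).trans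
    (cntBelow_mono (I.Bag t) hv))).trans (hZ.states_le t ht)

theorem keyStep_spec (hI : s.Holds I) (hZ : I.BddBy Z) {t t' v : ℕ} {c p : ℕ → ℕ} (htN : t < I.N)
    (ht : s.var 4 = t) (ht' : s.var 10 = t') (hv : s.var 8 = v) (hvn : v < I.n)
    (h3 : ∀ u ≤ v, I.Common t t' u → s.arr 3 u = c u)
    (h4 : ∀ u ≤ v, I.Common t t' u → s.arr 4 u = p u) (hc : ∀ u, c u < I.k)
    (hC : I.Common t t' v) (h11 : s.var 11 = cntBelow (I.Common t t') v)
    (h15 : s.var 15 = codeOf (I.Common t t') I.k c p v) :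
    Spec Z keyStepP s (60 * v + 40) fun s' => s'.var 11 = cntBelow (I.Common t t') (v + 1) ∧
      s'.var 15 = codeOf (I.Common t t') I.k c p (v + 1) := by
  have hcnt := cntBelow_le (I.Common t t') v
  refine Spec.le (Spec.set_seq (cntBelow (I.Common t t') (v + 1)) rfl
    (by simp [Expr.eval, h11, cntBelow_succ, hC])
    ((cntBelow_le _ _).trans ((Nat.succ_le_of_lt hvn).trans hZ.n_le)) <|
    Spec.seq (count_spec (I := I) (t := t) (t' := t') (v := v) (p := p) ?_ (by simp [ht])
      (by simp [ht']) (by simp [hv]) (by simpa using h4) hC) ?_ (T₂ := 14)) ?_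
  · constructor <;> try funext i
    all_goals simp [hI.n, hI.N, hI.k, hI.adj, hI.tree, hI.inc]
  · intro s' hs' hF h17
    have h8 := hF.var 8 rfl
    have h2 := hF.var 2 rfl
    have h11' := hF.var 11 rfl
    have h15' := hF.var 15 rfl
    have h3' := congrFun (hF.arr 3 rfl) v
    simp [hv, h15, h3 v le_rfl hC, hI.k] at h8 h11' h15' h3' h2
    refine (Spec.set (m := codeOf (I.Common t t') I.k c p (v + 1)) rfl ?_ ?_ ?_).le (by decide)
    · simp [Expr.eval, h8, h11', h15', h3', h17, h2, codeOf, hC, cntBelow_succ]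
    · exact (codeOf_lt c p (v + 1) fun u _ _ => hc u).le.trans (hZ.common_le t' htN hvn)
    · simp [h11']
  · simp only [Expr.cost]
    omega

theorem key_spec (hI : s.Holds I) (hZ : I.BddBy Z) {t t' : ℕ} {c p : ℕ → ℕ} (htN : t < I.N)
    (ht : s.var 4 = t) (ht' : s.var 10 = t')
    (h3 : ∀ u < I.n, I.Bag t u → s.arr 3 u = c u)
    (h4 : ∀ u < I.n, I.Bag t u → s.arr 4 u = p u) (hc : ∀ u, c u < I.k) :
    Spec Z keyP s (100 * (I.n + 1) ^ 2) fun s' =>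
      s'.var 15 = codeOf (I.Common t t') I.k c p I.n := by
  refine Spec.le (Spec.set_seq 0 rfl rfl (by simp) <| Spec.set_seq 0 rfl rfl (by simp) <|
    (Spec.forLoop (m := I.n) (T := 60 * I.n + 60) (by decide) rfl rfl (by simp [hI.n])
      (fun v s' => s'.var 11 = cntBelow (I.Common t t') v ∧
        s'.var 15 = codeOf (I.Common t t') I.k c p v)
      (by simp [codeOf]) ?_).imp ?_) ?_
  · intro v hv s' hs' hF h8 _ ⟨h11, h15⟩
    have hI' : s'.Holds I := by
      refine Mem.Holds.frame ?_ hF rfl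
      constructor <;> try funext i
      all_goals simp [hI.n, hI.N, hI.k, hI.adj, hI.tree, hI.inc]
    have ht4 : s'.var 4 = t := by rw [hF.var 4 rfl]; simp [ht]
    have ht10 : s'.var 10 = t' := by rw [hF.var 10 rfl]; simp [ht']
    have ha3 : s'.arr 3 = s.arr 3 := hF.arr 3 rfl
    have ha4 : s'.arr 4 = s.arr 4 := hF.arr 4 rfl
    have heval := hI'.eval_bothE_ne_zero ht4 ht10 h8
    refine Spec.le (Spec.ite (T := 60 * I.n + 40) rfl (fun h => ?_) fun h => ?_) ?_
    · refine ((keyStep_spec hI' hZ htN ht4 ht10 h8 hv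
        (fun u hu hC => by rw [ha3]; exact h3 u (by omega) hC.1)
        (fun u hu hC => by rw [ha4]; exact h4 u (by omega) hC.1) hc (heval.mp h) h11 h15).le
        (by omega)).imp ?_
      simp
    · have hC := (not_congr heval).mp (by simpa using h)
      refine (Spec.skip ⟨?_, ?_⟩).le (by omega)
      · simp [cntBelow_succ, hC, h11]
      · simp [codeOf, hC, h15]
    · simp [bothE, bagE, Expr.cost]
      omega
  · rintro s' _ _ ⟨⟨_, h15⟩, _⟩
    exact h15
  · simp only [Expr.cost]
    nlinarith

/-- With truncated subtraction, `1 - (a - b) - (b - a)` is nonzero exactly when `a = b`, and `p + 1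
- q` exactly when `q ≤ p`; products act as conjunctions. -/
theorem Mem.Holds.eval_conflictE_ne_zero (hI : s.Holds I) {t σ u v : ℕ} (ht : s.var 4 = t)
    (hu : s.var 8 = u) (hv : s.var 9 = v) (hun : u < I.n) (hvn : v < I.n)
    (h3 : ∀ v < I.n, I.Bag t v → s.arr 3 v = I.col t σ v ∧ s.arr 4 v = I.pos t σ v) :
    conflictE.eval s ≠ 0 ↔ I.Arc u v ∧ I.Bag t u ∧ I.Bag t v ∧ I.col t σ u = I.col t σ v ∧
      ¬ I.pos t σ u < I.pos t σ v := by
  simp only [conflictE, Expr.eval, hI.eval_bagE, mul_ne_zero_iff, ht, hu, hv, hI.n, hI.adj]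
  constructor
  · rintro ⟨⟨h₁, h₂, h₃⟩, h₄, h₅⟩
    rw [(h3 u hun h₂).1, (h3 v hvn h₃).1] at h₄
    rw [(h3 u hun h₂).2, (h3 v hvn h₃).2] at h₅
    exact ⟨h₁, h₂, h₃, by omega, by omega⟩
  · rintro ⟨h₁, h₂, h₃, h₄, h₅⟩
    refine ⟨⟨h₁, h₂, h₃⟩, ?_, ?_⟩
    · rw [(h3 u hun h₂).1, (h3 v hvn h₃).1]
      omega
    · rw [(h3 u hun h₂).2, (h3 v hvn h₃).2]
      omega

open Classical in
theorem valid_spec (hI : s.Holds I) {t σ : ℕ} (ht : s.var 4 = t)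
    (h3 : ∀ v < I.n, I.Bag t v → s.arr 3 v = I.col t σ v ∧ s.arr 4 v = I.pos t σ v) :
    Spec Z validP s (100 * (I.n + 1) ^ 2) fun s' => s'.var 14 = if I.Valid t σ then 1 else 0 := by
  refine Spec.of_bdd fun hs => ?_
  let bad : ℕ → ℕ → Prop := fun u v => I.Arc u v ∧ I.Bag t u ∧ I.Bag t v ∧
    I.col t σ u = I.col t σ v ∧ ¬ I.pos t σ u < I.pos t σ v
  have hone : 1 ≤ Z := by have := hs.two_le; omega
  refine Spec.le (Spec.set_seq 1 rfl rfl hone <|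
    (Spec.forLoop (m := I.n) (T := 80 * I.n + 6) (by decide) rfl rfl (by simp [hI.n])
      (fun i s' => s'.var 14 = if ∀ u < i, ∀ v < I.n, ¬ bad u v then 1 else 0)
      (by simp) ?_).imp ?_) ?_
  · intro i hi s' hs' hF h8 hn h14
    have ht' : s'.var 4 = t := by rw [hF.var 4 rfl]; simp [ht]
    have hI' : s'.Holds I := by
      refine Mem.Holds.frame ?_ hF rfl
      constructor <;> try funext i
      all_goals simp [hI.n, hI.N, hI.k, hI.adj, hI.tree, hI.inc]
    have ha3 : s'.arr 3 = s.arr 3 := hF.arr 3 rfl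
    have ha4 : s'.arr 4 = s.arr 4 := hF.arr 4 rfl
    refine Spec.le ((Spec.forLoop (m := I.n) (T := 70) (by decide) rfl rfl hn
      (fun j s'' => s''.var 14 = if (∀ u < i, ∀ v < I.n, ¬ bad u v) ∧ ∀ v < j, ¬ bad i v
        then 1 else 0) (by simp [h14]) ?_).imp ?_) (by omega)
    · intro j hj s'' hs'' hF' h9 _ hinv
      have heval : conflictE.eval s'' ≠ 0 ↔ bad i j :=
        (hI'.frame hF' rfl).eval_conflictE_ne_zero ((hF'.var 4 rfl).trans ht')
          ((hF'.var 8 rfl).trans h8) h9 hi hj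
          (by rw [hF'.arr 3 rfl, hF'.arr 4 rfl, ha3, ha4]; exact h3)
      refine Spec.le (Spec.ite (T := 10) rfl (fun h => ?_) fun h => ?_) (by decide)
      · refine (Spec.set rfl rfl (by simp [Expr.eval]) ?_).le (by decide)
        have : ¬ ∀ v < j + 1, ¬ bad i v := fun h' => h' j (by omega) (heval.mp h)
        simp only [this, and_false, if_false]
        simp [Expr.eval]
      · refine (Spec.skip ?_).le (by decide)
        have h := (not_congr heval).mp (by simpa using h)
        have : (∀ v < j + 1, ¬ bad i v) ↔ ∀ v < j, ¬ bad i v := by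
          refine ⟨fun h' v hv => h' v (by omega), fun h' v hv => ?_⟩
          rcases Nat.lt_succ_iff_lt_or_eq.mp hv with hv | rfl
          exacts [h' v hv, h]
        rw [Mem.setVar_var, if_neg (by decide), hinv]
        simp only [this]
    · rintro s'' _ _ ⟨h, _⟩
      have : (∀ u < i + 1, ∀ v < I.n, ¬ bad u v) ↔
          (∀ u < i, ∀ v < I.n, ¬ bad u v) ∧ ∀ v < I.n, ¬ bad i v := by
        refine ⟨fun h' => ⟨fun u hu => h' u (by omega), h' i (by omega)⟩, fun h' u hu => ?_⟩
        rcases Nat.lt_succ_iff_lt_or_eq.mp hu with hu | rfl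
        exacts [h'.1 u hu, h'.2]
      rw [Mem.setVar_var, if_neg (by decide), h]
      simp only [this]
  · rintro s' _ _ ⟨h, _⟩
    have : (∀ u < I.n, ∀ v < I.n, ¬ bad u v) ↔ I.Valid t σ := by
      simp only [bad, RawInput.Valid]
      refine forall₄_congr fun u _ v _ => ?_
      tauto
    simpa [this] using h
  · simp only [Expr.cost]
    nlinarith

end WordRAM

/-! ### The message table and the rounds. -/

namespace RawInput

variable (I : RawInput)

/-- The index of a table entry. -/
def index (κ r t t' : ℕ) : ℕ := ((κ * (I.N + 2) + r) * I.N + t) * I.N + t'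

/-- Distinct messages occupy distinct cells. Layers run up to N + 1 because round r ≤ N writes layer
r + 1, whence the radix N + 2. -/
theorem index_inj {κ r t t' κ' r' u u' : ℕ} (hr : r < I.N + 2) (hr' : r' < I.N + 2)
    (ht : t < I.N) (ht' : t' < I.N) (hu : u < I.N) (hu' : u' < I.N)
    (h : I.index κ r t t' = I.index κ' r' u u') : κ = κ' ∧ r = r' ∧ t = u ∧ t' = u' := by
  have split : ∀ a b a' b' m : ℕ, b < m → b' < m → a * m + b = a' * m + b' → a = a' ∧ b = b' := by
    intro a b a' b' m hb hb' h
    have h₂ := congrArg (· % m) h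
    simp only [Nat.mul_add_mod_self_right, Nat.mod_eq_of_lt hb, Nat.mod_eq_of_lt hb'] at h₂
    subst h₂
    exact ⟨Nat.eq_of_mul_eq_mul_right (by omega) (Nat.add_right_cancel h), rfl⟩
  obtain ⟨h, h₁⟩ := split _ _ _ _ _ ht' hu' h
  obtain ⟨h, h₂⟩ := split _ _ _ _ _ ht hu h
  obtain ⟨h, h₃⟩ := split _ _ _ _ _ hr hr' h
  exact ⟨h, h₃, h₂, h₁⟩

/-- The table holds the codes that were sent by the surviving states in the set `P`. -/
def Table (P : ℕ → ℕ → ℕ → Prop) (tab : ℕ → ℕ) : Prop :=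
  ∀ κ, ∀ r ≤ I.N, ∀ t' < I.N, ∀ t < I.N, tab (I.index κ (r + 1) t' t) ≠ 0 ↔
    ∃ σ, P r t σ ∧ I.Alive r t σ ∧ I.key t t' σ = κ

variable {I}

theorem Table.congr {P Q : ℕ → ℕ → ℕ → Prop} {tab : ℕ → ℕ} (h : I.Table P tab)
    (hPQ : ∀ r t σ, t < I.N → (P r t σ ↔ Q r t σ)) : I.Table Q tab := by
  intro κ r hr t' ht' t ht
  rw [h κ r hr t' ht' t ht]
  simp only [hPQ r t _ ht]

/-- A form without case distinction: in round 0 the condition on neighbors is vacuous. -/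
theorem alive_iff (r t σ : ℕ) : I.Alive r t σ ↔ I.Valid t σ ∧ ∀ t' < I.N, I.Edge t t' →
    ∀ ρ, r = ρ + 1 → ∃ σ' < I.states t', I.Alive ρ t' σ' ∧ I.key t' t σ' = I.key t t' σ := by
  cases r with
  | zero => simp [Alive]
  | succ r => simp [Alive]

end RawInput

namespace WordRAM
variable {I : RawInput} {Z : ℕ} {s : Mem}

/-- The arrays `3` and `4` hold the colors and positions of the state `σ` of the node `t`. -/
def Mem.Decoded (s : Mem) (I : RawInput) (t σ : ℕ) : Prop :=
  ∀ v < I.n, I.Bag t v → s.arr 3 v = I.col t σ v ∧ s.arr 4 v = I.pos t σ v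

theorem Mem.Decoded.key_spec {t t' σ : ℕ} (h : s.Decoded I t σ) (hI : s.Holds I) (hZ : I.BddBy Z)
    (htN : t < I.N) (ht : s.var 4 = t) (ht' : s.var 10 = t') :
    Spec Z keyP s (100 * (I.n + 1) ^ 2) fun s' => s'.var 15 = I.key t t' σ :=
  WordRAM.key_spec hI hZ htN ht ht' (fun v hv hB => (h v hv hB).1) (fun v hv hB => (h v hv hB).2)
    fun _ => codeCol_lt _ hZ.one_le_k _ _

theorem Mem.Holds.eval_indexE (hI : s.Holds I) (r : Expr) (t t' : ℕ) :
    (indexE r t t').eval s = I.index (s.var 15) (r.eval s) (s.var t) (s.var t') := by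
  simp [indexE, Expr.eval, hI.N, RawInput.index]

theorem send_spec (hI : s.Holds I) (hZ : I.BddBy Z) {r t σ : ℕ} (htN : t < I.N)
    (hr : s.var 3 = r) (ht : s.var 4 = t) (hd : s.Decoded I t σ) :
    Spec Z sendP s (I.N * (100 * (I.n + 1) ^ 2 + 50) + 6) fun s' => ∀ j, s'.arr 5 j ≠ 0 ↔
      (∃ t' < I.N, j = I.index (I.key t t' σ) (r + 1) t' t) ∨ s.arr 5 j ≠ 0 := by
  refine Spec.of_bdd fun hs => ?_
  have hone : 1 ≤ Z := by have := hs.two_le; omega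
  refine Spec.le ((Spec.forLoop (m := I.N) (T := 100 * (I.n + 1) ^ 2 + 40) (by decide) rfl rfl hI.N
    (fun i s' => ∀ j, s'.arr 5 j ≠ 0 ↔
      (∃ t' < i, j = I.index (I.key t t' σ) (r + 1) t' t) ∨ s.arr 5 j ≠ 0)
    (by simp) ?_).imp ?_) (by nlinarith)
  · intro i hi s' hs' hF h10 _ hinv
    have hI' := hI.frame hF rfl
    have h3 := (hF.var 3 rfl).trans hr
    have h4 := (hF.var 4 rfl).trans ht
    have hd' : s'.Decoded I t σ := by
      rw [Mem.Decoded, hF.arr 3 rfl, hF.arr 4 rfl]; exact hd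
    refine Spec.le (Spec.seq (hd'.key_spec hI' hZ htN h4 h10) (T₂ := 40) ?_) (by omega)
    intro s'' hs'' hF' h15
    refine (Spec.put (i := I.index (I.key t i σ) (r + 1) i t) (m := 1) rfl rfl ?_ rfl hone ?_).le
      (by decide)
    · rw [(hI'.frame hF' rfl).eval_indexE, h15, (hF'.var 10 rfl).trans h10,
        (hF'.var 4 rfl).trans h4]
      simp [Expr.eval, (hF'.var 3 rfl).trans h3]
    · intro j
      have h5 : s''.arr 5 = s'.arr 5 := hF'.arr 5 rfl
      have hsucc : (∃ t' < i + 1, j = I.index (I.key t t' σ) (r + 1) t' t) ↔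
          j = I.index (I.key t i σ) (r + 1) i t ∨
            ∃ t' < i, j = I.index (I.key t t' σ) (r + 1) t' t := by
        constructor
        · rintro ⟨t', ht', h⟩
          rcases Nat.lt_succ_iff_lt_or_eq.mp ht' with ht' | rfl
          exacts [.inr ⟨t', ht', h⟩, .inl h]
        · rintro (h | ⟨t', ht', h⟩)
          exacts [⟨i, by omega, h⟩, ⟨t', by omega, h⟩]
      rw [hsucc, or_assoc, ← hinv j, Mem.setVar_arr, Mem.setArr_arr, h5]
      by_cases hj : j = I.index (I.key t i σ) (r + 1) i t
      · simp [hj]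
      · simp [hj]
  · rintro s' _ _ ⟨h, _⟩
    exact h

open Classical in
-- Round `r` reads layer `r`, which round `r - 1` has filled, and so is not disturbed by the
-- messages of the current round.
theorem receive_spec (hI : s.Holds I) (hZ : I.BddBy Z) {r t σ : ℕ} (htN : t < I.N)
    (hr : s.var 3 = r) (ht : s.var 4 = t) (hd : s.Decoded I t σ)
    (h14 : s.var 14 = if I.Valid t σ then 1 else 0)
    (htab : ∀ ρ, r = ρ + 1 → ∀ t' < I.N, ∀ κ, s.arr 5 (I.index κ r t t') ≠ 0 ↔
      ∃ σ' < I.states t', I.Alive ρ t' σ' ∧ I.key t' t σ' = κ) :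
    Spec Z receiveP s (I.N * (100 * (I.n + 1) ^ 2 + 90) + 6) fun s' =>
      s'.var 14 = if I.Alive r t σ then 1 else 0 := by
  have hok : ∀ t' < I.N, (s.arr 5 (I.index (I.key t t' σ) r t t') ≠ 0 ∨ r = 0 ↔
      ∀ ρ, r = ρ + 1 → ∃ σ' < I.states t', I.Alive ρ t' σ' ∧ I.key t' t σ' = I.key t t' σ) := by
    intro t' ht'
    cases r with
    | zero => simp
    | succ ρ => simpa using htab ρ rfl t' ht' (I.key t t' σ)
  refine Spec.le ((Spec.forLoop (m := I.N) (T := 100 * (I.n + 1) ^ 2 + 80) (by decide) rfl rfl hI.N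
    (fun i s' => s'.var 14 = if I.Valid t σ ∧ ∀ t' < i, I.Edge t t' →
      s.arr 5 (I.index (I.key t t' σ) r t t') ≠ 0 ∨ r = 0 then 1 else 0)
    (by simp [h14]) ?_).imp ?_) (by nlinarith)
  · intro i hi s' hs' hF h10 _ hinv
    have hI' := hI.frame hF rfl
    have h3 := (hF.var 3 rfl).trans hr
    have h4 := (hF.var 4 rfl).trans ht
    have hd' : s'.Decoded I t σ := by
      rw [Mem.Decoded, hF.arr 3 rfl, hF.arr 4 rfl]; exact hd
    have hsucc : (∀ t' < i + 1, I.Edge t t' →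
        s.arr 5 (I.index (I.key t t' σ) r t t') ≠ 0 ∨ r = 0) ↔
        (∀ t' < i, I.Edge t t' → s.arr 5 (I.index (I.key t t' σ) r t t') ≠ 0 ∨ r = 0) ∧
        (I.Edge t i → s.arr 5 (I.index (I.key t i σ) r t i) ≠ 0 ∨ r = 0) := by
      refine ⟨fun h => ⟨fun t' ht' => h t' (by omega), h i (by omega)⟩, fun h t' ht' => ?_⟩
      rcases Nat.lt_succ_iff_lt_or_eq.mp ht' with ht' | rfl
      exacts [h.1 t' ht', h.2]
    have hedge : Expr.eval s' (.get 1 (.add (.mul (.var 4) (.var 1)) (.var 10))) ≠ 0 ↔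
        I.Edge t i := by
      simp [Expr.eval, hI'.tree, h4, h10, hI'.N, RawInput.Edge]
    refine Spec.le (Spec.ite (T := 100 * (I.n + 1) ^ 2 + 60) rfl (fun h => ?_) fun h => ?_) ?_
    · refine Spec.le (Spec.seq (hd'.key_spec hI' hZ htN h4 h10) (T₂ := 50) ?_) (by omega)
      intro s'' hs'' hF' h15
      -- The summand `1 - r` makes the test succeed in round 0, where there are no messages yet.
      have heval : Expr.eval s'' (.add (.get 5 (indexE (.var 3) 4 10)) (.sub (.lit 1) (.var 3))) ≠ 0
          ↔ s.arr 5 (I.index (I.key t i σ) r t i) ≠ 0 ∨ r = 0 := by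
        simp only [Expr.eval, (hI'.frame hF' rfl).eval_indexE, h15, (hF'.var 10 rfl).trans h10,
          (hF'.var 4 rfl).trans h4, (hF'.var 3 rfl).trans h3, hF'.arr 5 rfl, hF.arr 5 rfl]
        omega
      have h14' := (hF'.var 14 rfl).trans hinv
      refine Spec.le (Spec.ite (T := 3) rfl (fun h' => ?_) fun h' => ?_) (by decide)
      · refine (Spec.skip ?_).le (by decide)
        have := heval.mp h'
        rw [Mem.setVar_var, if_neg (by decide), h14']
        simp only [hsucc, this, implies_true, and_true]
      · have h' := (not_congr heval).mp (by simpa using h')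
        refine (Spec.set rfl rfl (by simp [Expr.eval]) ?_).le (by decide)
        rw [if_neg]
        · simp [Expr.eval]
        · rw [hsucc]
          exact fun h'' => h' (h''.2.2 (hedge.mp h))
    · have h := (not_congr hedge).mp (by simpa using h)
      refine (Spec.skip ?_).le (by omega)
      rw [Mem.setVar_var, if_neg (by decide), hinv]
      simp only [hsucc, h, false_implies, and_true]
    · simp only [Expr.cost]
      omega
  · rintro s' _ _ ⟨h, _⟩
    rw [h]
    congr 1
    rw [RawInput.alive_iff, eq_iff_iff]
    refine and_congr_right fun _ => forall₃_congr fun t' ht' _ => hok t' ht'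

open Classical in
-- `P` is the set of triples processed so far. The hypothesis `hP` says that the previous round is
-- complete, so a missing message really means that no suitable neighboring state exists.
theorem state_spec (hI : s.Holds I) (hZ : I.BddBy Z) {r t σ : ℕ} {P : ℕ → ℕ → ℕ → Prop}
    (htN : t < I.N) (hrN : r ≤ I.N) (hr : s.var 3 = r) (ht : s.var 4 = t) (hσ : s.var 5 = σ)
    (hP : ∀ ρ, r = ρ + 1 → ∀ t' < I.N, ∀ σ', P ρ t' σ' ↔ σ' < I.states t')
    (htab : I.Table P (s.arr 5)) :
    Spec Z stateP s (1000 * (I.n + 1) ^ 2 * (I.N + 1)) fun s' =>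
      I.Table (fun r' t' σ' => P r' t' σ' ∨ r' = r ∧ t' = t ∧ σ' = σ) (s'.arr 5) ∧
      s'.var 7 = if I.Alive r t σ then 1 else s.var 7 := by
  refine Spec.of_bdd fun hs => ?_
  have hone : 1 ≤ Z := by have := hs.two_le; omega
  refine Spec.le (Spec.seq (decode_spec hI hZ htN ht hσ)
    (T₂ := 100 * (I.n + 1) ^ 2 + (I.N * (200 * (I.n + 1) ^ 2 + 140) + 30)) ?_) ?_
  · intro s₁ _ hF₁ ⟨_, hd₁⟩
    have hI₁ := hI.frame hF₁ rfl
    refine Spec.seq (valid_spec hI₁ ((hF₁.var 4 rfl).trans ht) hd₁) ?_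
    intro s₂ _ hF₂ h14
    have hI₂ := hI₁.frame hF₂ rfl
    have h3 := (hF₂.var 3 rfl).trans ((hF₁.var 3 rfl).trans hr)
    have h4 := (hF₂.var 4 rfl).trans ((hF₁.var 4 rfl).trans ht)
    have h5 : s₂.arr 5 = s.arr 5 := (hF₂.arr 5 rfl).trans (hF₁.arr 5 rfl)
    have hd₂ : s₂.Decoded I t σ := by
      rw [Mem.Decoded, hF₂.arr 3 rfl, hF₂.arr 4 rfl]; exact hd₁
    refine Spec.le (Spec.seq (receive_spec (r := r) hI₂ hZ htN h3 h4 hd₂ h14 ?_)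
      (T₂ := I.N * (100 * (I.n + 1) ^ 2 + 50) + 20) ?_) (by nlinarith)
    · rintro ρ rfl t' ht' κ
      rw [h5, htab κ ρ (by omega) t htN t' ht']
      simp only [hP ρ rfl t' ht']
    · intro s₃ _ hF₃ h14'
      have h7 : s₃.var 7 = s.var 7 :=
        (hF₃.var 7 rfl).trans ((hF₂.var 7 rfl).trans (hF₁.var 7 rfl))
      have h5' : s₃.arr 5 = s.arr 5 := (hF₃.arr 5 rfl).trans h5
      refine Spec.le (Spec.ite (T := I.N * (100 * (I.n + 1) ^ 2 + 50) + 8) rfl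
        (fun h => ?_) fun h => ?_) (by simp only [Expr.cost]; omega)
      · have hal : I.Alive r t σ := by
          by_contra hal
          simp [Expr.eval, h14', hal] at h
        refine Spec.le (Spec.set_seq 1 rfl rfl hone ((send_spec (I := I) (t := t) (r := r) (σ := σ)
          ?_ hZ htN ?_ ?_ ?_).imp ?_)) (by simp only [Expr.cost]; omega)
        · have hI₃ := hI₂.frame hF₃ rfl
          constructor <;> try funext i
          all_goals simp [hI₃.n, hI₃.N, hI₃.k, hI₃.adj, hI₃.tree, hI₃.inc]
        · simpa using (hF₃.var 3 rfl).trans h3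
        · simpa using (hF₃.var 4 rfl).trans h4
        · rw [Mem.Decoded, Mem.setVar_arr, hF₃.arr 3 rfl, hF₃.arr 4 rfl]; exact hd₂
        · intro s₄ _ hF₄ hsend
          refine ⟨?_, ?_⟩
          · intro κ r' hr' t' ht' t'' ht''
            rw [hsend, Mem.setVar_arr, h5', htab κ r' hr' t' ht' t'' ht'']
            constructor
            · rintro (⟨u, hu, he⟩ | ⟨σ', h₁, h₂⟩)
              · obtain ⟨rfl, h₂, rfl, rfl⟩ := I.index_inj (by omega) (by omega) ht' ht'' hu htN he
                obtain rfl : r' = r := by omega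
                exact ⟨σ, .inr ⟨rfl, rfl, rfl⟩, hal, rfl⟩
              · exact ⟨σ', .inl h₁, h₂⟩
            · rintro ⟨σ', h₁ | ⟨rfl, rfl, rfl⟩, h₂, h₃⟩
              · exact .inr ⟨σ', h₁, h₂, h₃⟩
              · exact .inl ⟨t', ht', by rw [h₃]⟩
          · rw [hF₄.var 7 rfl]
            simp [hal]
      · have hal : ¬ I.Alive r t σ := by
          intro hal
          simp [Expr.eval, h14', hal] at h
        refine (Spec.skip ⟨?_, ?_⟩).le (by omega)
        · rw [h5']
          intro κ r' hr' t' ht' t'' ht''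
          rw [htab κ r' hr' t' ht' t'' ht'']
          constructor
          · rintro ⟨σ', h₁, h₂⟩
            exact ⟨σ', .inl h₁, h₂⟩
          · rintro ⟨σ', h₁ | ⟨rfl, rfl, rfl⟩, h₂⟩
            · exact ⟨σ', h₁, h₂⟩
            · exact absurd h₂.1 hal
        · simp [hal, h7]
  · have hA : 1 ≤ (I.n + 1) ^ 2 := Nat.one_le_pow _ _ (Nat.succ_pos _)
    nlinarith [Nat.mul_le_mul_left I.N hA]

open Classical in
-- State 0 is decoded first only because decoding also computes the number of states, which is the
-- loop bound.
theorem node_spec (hI : s.Holds I) (hZ : I.BddBy Z) {r t S : ℕ} {P : ℕ → ℕ → ℕ → Prop}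
    (htN : t < I.N) (hrN : r ≤ I.N) (hS : I.states t ≤ S) (hr : s.var 3 = r) (ht : s.var 4 = t)
    (hP : ∀ ρ, r = ρ + 1 → ∀ t' < I.N, ∀ σ', P ρ t' σ' ↔ σ' < I.states t')
    (htab : I.Table P (s.arr 5)) :
    Spec Z nodeP s (2000 * (I.n + 1) ^ 2 * (I.N + 1) * S) fun s' =>
      I.Table (fun r' t' σ' => P r' t' σ' ∨ r' = r ∧ t' = t ∧ σ' < I.states t) (s'.arr 5) ∧
      s'.var 7 = if ∃ σ < I.states t, I.Alive r t σ then 1 else 0 := by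
  refine Spec.of_bdd fun hs => ?_
  have hS1 : 1 ≤ S := (codeCard_pos _ hZ.one_le_k _).trans_le hS
  have hA : 1 ≤ (I.n + 1) ^ 2 := Nat.one_le_pow _ _ (Nat.succ_pos _)
  refine Spec.le (Spec.set_seq 0 rfl rfl (by simp) (Spec.seq
    (decode_spec (I := I) (t := t) (σ := 0) ?_ hZ htN (by simp [ht]) (by simp))
    (T₂ := I.states t * (1000 * (I.n + 1) ^ 2 * (I.N + 1) + 8) + 20) ?_)) ?_
  · constructor <;> try funext i
    all_goals simp [hI.n, hI.N, hI.k, hI.adj, hI.tree, hI.inc]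
  · intro s₁ _ hF₁ ⟨h16, _⟩
    have h3 := (hF₁.var 3 rfl)
    have h4 := (hF₁.var 4 rfl)
    have h5 := (hF₁.arr 5 rfl)
    have hI₁ : s₁.Holds I := by
      refine Mem.Holds.frame ?_ hF₁ rfl
      constructor <;> try funext i
      all_goals simp [hI.n, hI.N, hI.k, hI.adj, hI.tree, hI.inc]
    simp [hr, ht] at h3 h4 h5
    refine Spec.le (Spec.set_seq (I.states t) rfl (by simp [Expr.eval, h16]) (hZ.states_le t htN) <|
      Spec.set_seq 0 rfl rfl (by simp) <|
      (Spec.forLoop (m := I.states t) (T := 1000 * (I.n + 1) ^ 2 * (I.N + 1)) (by decide) rfl rfl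
      (by simp) (fun i s' =>
        I.Table (fun r' t' σ' => P r' t' σ' ∨ r' = r ∧ t' = t ∧ σ' < i) (s'.arr 5) ∧
        s'.var 7 = if ∃ σ < i, I.Alive r t σ then 1 else 0) (by simp [h5, htab]) ?_).imp ?_)
      (by simp only [Expr.cost]; omega)
    · rintro i hi s' _ hF hv5 _ ⟨htab', h7⟩
      have hI' : s'.Holds I := by
        refine Mem.Holds.frame ?_ hF rfl
        constructor <;> try funext i
        all_goals simp [hI₁.n, hI₁.N, hI₁.k, hI₁.adj, hI₁.tree, hI₁.inc]
      have h3' : s'.var 3 = r := by rw [hF.var 3 rfl]; simp [h3]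
      have h4' : s'.var 4 = t := by rw [hF.var 4 rfl]; simp [h4]
      refine (state_spec hI' hZ htN hrN h3' h4' hv5 ?_ htab').imp ?_
      · rintro ρ rfl t' ht' σ'
        rw [← hP ρ rfl t' ht']
        simp
      · rintro s'' _ _ ⟨h₁, h₂⟩
        refine ⟨?_, ?_⟩
        · refine h₁.congr fun r' t' σ' _ => ?_
          rw [or_assoc, ← and_or_left, ← and_or_left, Nat.lt_succ_iff_lt_or_eq]
        · rw [Mem.setVar_var, if_neg (by decide), h₂, h7]
          have : (∃ σ < i + 1, I.Alive r t σ) ↔ I.Alive r t i ∨ ∃ σ < i, I.Alive r t σ := by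
            constructor
            · rintro ⟨σ, hσ, h⟩
              rcases Nat.lt_succ_iff_lt_or_eq.mp hσ with hσ | rfl
              exacts [.inr ⟨σ, hσ, h⟩, .inl h]
            · rintro (h | ⟨σ, hσ, h⟩)
              exacts [⟨i, by omega, h⟩, ⟨σ, by omega, h⟩]
          simp only [this]
          by_cases hal : I.Alive r t i <;> simp [hal]
    · rintro s' _ _ ⟨h, _⟩
      exact h
  · have h₁ : I.states t * (1000 * (I.n + 1) ^ 2 * (I.N + 1) + 8) ≤
        S * (1008 * (I.n + 1) ^ 2 * (I.N + 1)) := by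
      refine Nat.mul_le_mul hS ?_
      nlinarith [Nat.mul_le_mul_left I.N hA]
    have h₂ : (I.n + 1) ^ 2 ≤ (I.n + 1) ^ 2 * (I.N + 1) * S := by
      calc (I.n + 1) ^ 2 = (I.n + 1) ^ 2 * 1 * 1 := by ring
        _ ≤ _ := Nat.mul_le_mul (Nat.mul_le_mul_left _ (by omega)) hS1
    simp only [Expr.cost]
    nlinarith

open Classical in
-- Variable `7` is reset for every node, so at the end it speaks of the last node N - 1 in the last
-- of the N + 1 rounds. This node will be the root.
theorem rounds_spec (hI : s.Holds I) (hZ : I.BddBy Z) {S : ℕ} (hN : 1 ≤ I.N) (hNZ : I.N + 1 ≤ Z)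
    (hS1 : 1 ≤ S) (hS : ∀ t < I.N, I.states t ≤ S) (htab : ∀ j, s.arr 5 j = 0) :
    Spec Z roundsP s (4000 * (I.n + 1) ^ 2 * (I.N + 1) ^ 3 * S) fun s' =>
      s'.var 7 = if ∃ σ < I.states (I.N - 1), I.Alive I.N (I.N - 1) σ then 1 else 0 := by
  refine Spec.le (Spec.set_seq (I.N + 1) rfl (by simp [Expr.eval, hI.N]) hNZ <|
    (Spec.forLoop (m := I.N + 1) (T := I.N * (2000 * (I.n + 1) ^ 2 * (I.N + 1) * S + 8) + 6)
      (by decide) rfl rfl (by simp) (fun i s' =>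
        I.Table (fun r t σ => r < i ∧ σ < I.states t) (s'.arr 5) ∧
        ∀ r, i = r + 1 → s'.var 7 =
          if ∃ σ < I.states (I.N - 1), I.Alive r (I.N - 1) σ then 1 else 0)
      (by simp [RawInput.Table, htab]) ?_).imp ?_) ?_
  · rintro r hr s₁ _ hF₁ h3 _ ⟨htab₁, _⟩
    have hI₁ : s₁.Holds I := by
      refine Mem.Holds.frame ?_ hF₁ rfl
      constructor <;> try funext i
      all_goals simp [hI.n, hI.N, hI.k, hI.adj, hI.tree, hI.inc]
    refine Spec.le ((Spec.forLoop (m := I.N) (T := 2000 * (I.n + 1) ^ 2 * (I.N + 1) * S)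
      (by decide) rfl rfl hI₁.N (fun i s' =>
        I.Table (fun r' t σ => (r' < r ∨ r' = r ∧ t < i) ∧ σ < I.states t) (s'.arr 5) ∧
        ∀ t, i = t + 1 → s'.var 7 = if ∃ σ < I.states t, I.Alive r t σ then 1 else 0)
      (by simpa using htab₁) ?_).imp ?_) (by omega)
    · rintro t ht s₂ _ hF₂ h4 _ ⟨htab₂, _⟩
      refine (node_spec (hI₁.frame hF₂ rfl) hZ ht (by omega) (hS t ht) ((hF₂.var 3 rfl).trans h3) h4
        ?_ htab₂).imp ?_
      · rintro ρ rfl t' ht' σ'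
        simp
      · rintro s₃ _ _ ⟨h₁, h₂⟩
        refine ⟨h₁.congr fun r' t' σ' _ => ?_, ?_⟩
        · rw [Nat.lt_succ_iff_lt_or_eq]
          constructor
          · rintro (⟨h | ⟨rfl, h⟩, h'⟩ | ⟨rfl, rfl, h⟩)
            exacts [⟨.inl h, h'⟩, ⟨.inr ⟨rfl, .inl h⟩, h'⟩, ⟨.inr ⟨rfl, .inr rfl⟩, h⟩]
          · rintro ⟨h | ⟨rfl, h | rfl⟩, h'⟩
            exacts [.inl ⟨.inl h, h'⟩, .inl ⟨.inr ⟨rfl, h⟩, h'⟩, .inr ⟨rfl, rfl, h'⟩]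
        · intro t' ht'
          obtain rfl : t = t' := by omega
          simpa using h₂
    · rintro s' _ _ ⟨⟨h₁, h₂⟩, _⟩
      refine ⟨h₁.congr fun r' t' σ' ht' => ?_, ?_⟩
      · rw [Nat.lt_succ_iff_lt_or_eq]
        simp [ht']
      · intro r' hr'
        obtain rfl : r = r' := by omega
        simpa using h₂ (I.N - 1) (by omega)
  · rintro s' _ _ ⟨⟨_, h⟩, _⟩
    exact h I.N rfl
  · have hA : 1 ≤ (I.n + 1) ^ 2 := Nat.one_le_pow _ _ (Nat.succ_pos _)
    have h₁ : 1 ≤ (I.n + 1) ^ 2 * S := Nat.mul_pos hA hS1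
    simp only [Expr.cost]
    generalize (I.n + 1) ^ 2 = A at *
    have h₂ : I.N * (2000 * A * (I.N + 1) * S + 8) ≤ 2008 * (A * S) * (I.N + 1) ^ 2 := by
      nlinarith [Nat.mul_le_mul_left I.N h₁]
    have h₃ : (I.N + 1) ≤ (A * S) * (I.N + 1) ^ 3 := by
      calc I.N + 1 = 1 * (I.N + 1) ^ 1 := by ring
        _ ≤ _ := Nat.mul_le_mul h₁ (Nat.pow_le_pow_right (by omega) (by omega))
    calc _ = (I.N + 1) * (I.N * (2000 * A * (I.N + 1) * S + 8)) + 14 * (I.N + 1) + 10 := by ring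
      _ ≤ (I.N + 1) * (2008 * (A * S) * (I.N + 1) ^ 2) + 14 * (I.N + 1) + 10 * (I.N + 1) := by
        gcongr; omega
      _ = 2008 * ((A * S) * (I.N + 1) ^ 3) + 24 * (I.N + 1) := by ring
      _ ≤ 2008 * ((A * S) * (I.N + 1) ^ 3) + 24 * ((A * S) * (I.N + 1) ^ 3) := by gcongr
      _ ≤ 4000 * ((A * S) * (I.N + 1) ^ 3) := by omega
      _ = _ := by ring

end WordRAM

/-! ### Trees -/

section Tree

open Relation

/-- The union of an acyclic relation on `U` and a strict order is acyclic if the order is contained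
in the relation on `U`. -/
theorem not_transGen_union {V : Type*} {R L : V → V → Prop} {U : V → Prop}
    (hR : ∀ x y, R x y → U x ∧ U y)
    (hRacyc : ∀ x, ¬ TransGen R x x) (hLtrans : ∀ x y z, L x y → L y z → L x z)
    (hLirrefl : ∀ x, ¬ L x x) (hLR : ∀ x y, U x → U y → L x y → R x y) (x : V) :
    ¬ TransGen (fun a b => R a b ∨ L a b) x x := by
  -- Outside `U` a walk can use only `L`, so by transitivity each excursion shrinks to one `L`-step.
  -- If its ends lie in `U`, that step is also in `R`.
  have key : ∀ z, U z → ∀ y, TransGen (fun a b => R a b ∨ L a b) y z →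
      (U y → TransGen R y z) ∧ (¬ U y → ∃ w, U w ∧ L y w ∧ ReflTransGen R w z) := by
    intro z hz y h
    induction h using TransGen.head_induction_on with
    | @single y h =>
      rcases h with h | h
      · exact ⟨fun _ => .single h, fun hy => absurd (hR _ _ h).1 hy⟩
      · exact ⟨fun hy => .single (hLR _ _ hy hz h), fun _ => ⟨z, hz, h, .refl⟩⟩
    | @head y y' h _ ih =>
      rcases h with h | h
      · exact ⟨fun _ => .head h (ih.1 (hR _ _ h).2), fun hy => absurd (hR _ _ h).1 hy⟩
      · by_cases hy' : U y'
        · exact ⟨fun hy => .head (hLR _ _ hy hy' h) (ih.1 hy'),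
            fun _ => ⟨y', hy', h, (ih.1 hy').to_reflTransGen⟩⟩
        · obtain ⟨w, hw, hyw, hwz⟩ := ih.2 hy'
          have hyw := hLtrans _ _ _ h hyw
          exact ⟨fun hy => TransGen.head' (hLR _ _ hy hw hyw) hwz, fun _ => ⟨w, hw, hyw, hwz⟩⟩
  have cyc : ∀ x, U x → ¬ TransGen (fun a b => R a b ∨ L a b) x x :=
    fun x hx h => hRacyc x ((key x hx x h).1 hx)
  intro h
  -- A walk either consists of `L`-steps only, and contracts to one of them, or meets `U`; in the
  -- second case a closed walk can be rotated to start in `U`.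
  have split : ∀ y, TransGen (fun a b => R a b ∨ L a b) x y →
      L x y ∨ ∃ u, U u ∧ ReflTransGen (fun a b => R a b ∨ L a b) x u ∧
        ReflTransGen (fun a b => R a b ∨ L a b) u y := by
    intro y h
    induction h with
    | @single y h =>
      rcases id h with h' | h'
      · exact .inr ⟨y, (hR _ _ h').2, .single h, .refl⟩
      · exact .inl h'
    | @tail y z hxy h ih =>
      rcases ih with ih | ⟨u, hu, h₁, h₂⟩
      · rcases id h with h' | h'
        · exact .inr ⟨z, (hR _ _ h').2, hxy.to_reflTransGen.tail h, .refl⟩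
        · exact .inl (hLtrans _ _ _ ih h')
      · exact .inr ⟨u, hu, h₁, h₂.tail h⟩
  rcases split x h with h' | ⟨u, hu, h₁, h₂⟩
  · exact hLirrefl x h'
  · rcases reflTransGen_iff_eq_or_transGen.mp h₁ with rfl | h₁
    · exact cyc _ hu h
    · exact cyc u hu (TransGen.trans_right h₂ h₁)

/-- A rooted tree, given by the parents and the depths of the nodes. -/
structure ParentTree (ι : Type*) where
  root : ι
  parent : ι → ι
  depth : ι → ℕ
  depth_root : depth root = 0
  depth_parent : ∀ t, t ≠ root → depth (parent t) + 1 = depth t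

namespace ParentTree

variable {ι V : Type*} (F : ParentTree ι)

/-- `a` and `b` are the ends of an edge of the tree. -/
def Adj (a b : ι) : Prop := (a ≠ F.root ∧ b = F.parent a) ∨ (b ≠ F.root ∧ a = F.parent b)

/-- Choose states from the root to the leaves. -/
theorem exists_assignment {α : Type*} (A : ℕ → ι → α → Prop) (Q : ι → α → ι → α → Prop) (N : ℕ)
    (hN : ∀ t, F.depth t ≤ N) (a₀ : α) (h₀ : A N F.root a₀)
    (step : ∀ r t a, t ≠ F.root → A (r + 1) (F.parent t) a → ∃ b, A r t b ∧ Q (F.parent t) a t b) :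
    ∃ f : ι → α, ∀ t, A (N - F.depth t) t (f t) ∧
      (t ≠ F.root → Q (F.parent t) (f (F.parent t)) t (f t)) := by
  classical
  have hroot : ∀ t, F.depth t = 0 → t = F.root := by
    intro t ht
    by_contra h
    have := F.depth_parent t h
    omega
  -- The choice is made level by level. Each step down the tree uses up one round of survival, so
  -- depth d has N - d rounds left.
  have main : ∀ d, ∃ f : ι → α, ∀ t, F.depth t ≤ d → A (N - F.depth t) t (f t) ∧
      (t ≠ F.root → Q (F.parent t) (f (F.parent t)) t (f t)) := by
    intro d
    induction d with
    | zero =>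
      refine ⟨fun _ => a₀, fun t ht => ?_⟩
      obtain rfl := hroot t (by omega)
      exact ⟨by simpa [F.depth_root] using h₀, fun h => absurd rfl h⟩
    | succ d ih =>
      obtain ⟨f, hf⟩ := ih
      have : ∀ t, ∃ b, F.depth t = d + 1 →
          A (N - F.depth t) t b ∧ Q (F.parent t) (f (F.parent t)) t b := by
        intro t
        by_cases ht : F.depth t = d + 1
        · have htr : t ≠ F.root := by
            rintro rfl
            rw [F.depth_root] at ht
            omega
          have hp := F.depth_parent t htr
          have hA := (hf (F.parent t) (by omega)).1
          have hNt := hN t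
          rw [show N - F.depth (F.parent t) = N - F.depth t + 1 by omega] at hA
          obtain ⟨b, hb⟩ := step _ t _ htr hA
          exact ⟨b, fun _ => hb⟩
        · exact ⟨a₀, fun h => absurd h ht⟩
      choose g hg using this
      refine ⟨fun t => if F.depth t ≤ d then f t else g t, fun t ht => ?_⟩
      by_cases h : F.depth t ≤ d
      · refine ⟨by simpa [h] using (hf t h).1, fun htr => ?_⟩
        have hp := F.depth_parent t htr
        have hp' : F.depth (F.parent t) ≤ d := by omega
        simpa [h, hp'] using (hf t h).2 htr
      · have hd : F.depth t = d + 1 := by omega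
        refine ⟨by simpa [h] using (hg t hd).1, fun htr => ?_⟩
        have hp := F.depth_parent t htr
        have hp' : F.depth (F.parent t) ≤ d := by omega
        simpa [h, hp'] using (hg t hd).2
  obtain ⟨f, hf⟩ := main N
  exact ⟨f, fun t => hf t (hN t)⟩

/-- A path that starts in the subtree of `t` and leaves it passes through the parent of `t`. -/
theorem mem_parent_of_path {P : ι → Prop} {t b : ι}
    (hpath : ReflTransGen (fun a b => P b ∧ F.Adj a b) t b) (hb : b ≠ t)
    (hd : F.depth b ≤ F.depth t) : P (F.parent t) := by
  -- `below` is the subtree of `t`. A step out of it must go to the parent of `t`, and every node of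
  -- it other than `t` is deeper than `t`, so `b` lies outside.
  let below : ι → Prop := fun s => ReflTransGen (fun a b => a ≠ F.root ∧ b = F.parent a) s t
  have hlt : ∀ s, below s → s = t ∨ F.depth t < F.depth s := by
    intro s hs
    induction hs using ReflTransGen.head_induction_on with
    | refl => exact .inl rfl
    | head h _ ih =>
      obtain ⟨h, rfl⟩ := h
      have := F.depth_parent _ h
      rcases ih with rfl | ih
      · right; omega
      · right; omega
  have main : ∀ s, ReflTransGen (fun a b => P b ∧ F.Adj a b) t s → below s ∨ P (F.parent t) := by
    intro s hs
    induction hs with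
    | refl => exact .inl .refl
    | @tail a c _ h ih =>
      rcases ih with ih | ih
      · obtain ⟨hP, ⟨ha, rfl⟩ | ⟨hc, rfl⟩⟩ := h
        · rcases ReflTransGen.cases_head ih with rfl | ⟨_, ⟨_, rfl⟩, h⟩
          exacts [.inr hP, .inl h]
        · exact .inl (ReflTransGen.head ⟨hc, rfl⟩ ih)
      · exact .inr ih
  rcases main b hpath with h | h
  · rcases hlt b h with h | h
    exacts [absurd h hb, absurd hd (by omega)]
  · exact h

/-- The union of strict orders on the bags of a tree decomposition that agree along the edges of the
tree is acyclic. -/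
theorem not_transGen_exists [Fintype ι] (B : ι → V → Prop) (L : ι → V → V → Prop)
    (hL : ∀ t x y, L t x y → B t x ∧ B t y) (htrans : ∀ t x y z, L t x y → L t y z → L t x z)
    (hirrefl : ∀ t x, ¬ L t x x)
    (hagree : ∀ t, t ≠ F.root → ∀ x y, B (F.parent t) x → B (F.parent t) y → L t x y →
      L (F.parent t) x y)
    (hconn : ∀ x t t', B t x → B t' x → ReflTransGen (fun a b => B b x ∧ F.Adj a b) t t') (x : V) :
    ¬ TransGen (fun a b => ∃ t, L t a b) x x := by
  classical
  -- Induction over sets of nodes closed under parents; removing a deepest node keeps them closed.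
  have main : ∀ (m : ℕ) (S : Finset ι), S.card = m →
      (∀ t ∈ S, t ≠ F.root → F.parent t ∈ S) →
      ∀ x, ¬ TransGen (fun a b => ∃ t ∈ S, L t a b) x x := by
    intro m
    induction m with
    | zero =>
      intro S hS _ x h
      obtain rfl := Finset.card_eq_zero.mp hS
      obtain ⟨_, h, _⟩ := TransGen.head'_iff.mp h
      simp at h
    | succ m ih =>
      intro S hS hclosed x h
      obtain ⟨t, ht, hmax⟩ := S.exists_max_image F.depth
        (Finset.card_pos.mp (by omega))
      have hclosed' : ∀ s ∈ S.erase t, s ≠ F.root → F.parent s ∈ S.erase t := by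
        intro s hs hsr
        have hs' := Finset.mem_of_mem_erase hs
        refine Finset.mem_erase.mpr ⟨?_, hclosed s hs' hsr⟩
        rintro rfl
        have h₁ := F.depth_parent s hsr
        have h₂ := hmax s hs'
        omega
      refine not_transGen_union (R := fun a b => ∃ s ∈ S.erase t, L s a b) (L := L t)
        (U := fun x => ∃ s ∈ S.erase t, B s x) ?_
        (ih _ (by rw [Finset.card_erase_of_mem ht]; omega) hclosed') (htrans t) (hirrefl t) ?_ x
        (TransGen.mono ?_ _ _ h)
      · rintro a b ⟨s, hs, h⟩
        exact ⟨⟨s, hs, (hL s a b h).1⟩, ⟨s, hs, (hL s a b h).2⟩⟩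
      · rintro a b ⟨s, hs, ha⟩ ⟨s', hs', hb⟩ h
        -- If the deepest node were the root, all nodes of `S` would have depth 0, so no other node
        -- would be left to share vertices with.
        have htr : t ≠ F.root := by
          rintro rfl
          refine Finset.ne_of_mem_erase hs ?_
          by_contra hsr
          have h₁ := F.depth_parent s hsr
          have h₂ := hmax s (Finset.mem_of_mem_erase hs)
          have h₃ := F.depth_root
          omega
        have hpar : F.parent t ∈ S.erase t := by
          refine Finset.mem_erase.mpr ⟨fun he => ?_, hclosed t ht htr⟩
          have := F.depth_parent t htr
          rw [he] at this
          omega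
        have hmem : ∀ s ∈ S.erase t, ∀ x, B s x → B t x → B (F.parent t) x := by
          intro s hs x hsx htx
          exact F.mem_parent_of_path (P := fun a => B a x) (hconn x t s htx hsx)
            (Finset.ne_of_mem_erase hs) (hmax s (Finset.mem_of_mem_erase hs))
        exact ⟨F.parent t, hpar, hagree t htr a b (hmem s hs a ha (hL t a b h).1)
          (hmem s' hs' b hb (hL t a b h).2) h⟩
      · rintro a b ⟨s, hs, h⟩
        by_cases hst : s = t
        · exact .inr (hst ▸ h)
        · exact .inl ⟨s, Finset.mem_erase.mpr ⟨hst, hs⟩, h⟩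
  intro h
  refine main _ Finset.univ rfl (fun t _ _ => Finset.mem_univ _) x
    (TransGen.mono ?_ _ _ h)
  rintro a b ⟨t, h⟩
  exact ⟨t, Finset.mem_univ _, h⟩

end ParentTree

/-- The parent is the second vertex of the unique path to the root, the depth the length of this
path. For an edge ab, either b lies on the path of a and is then its second vertex, or prepending b
yields the path of b, whose second vertex is a. -/
theorem SimpleGraph.IsTree.exists_parentTree {ι : Type*} [Fintype ι] {G : SimpleGraph ι}
    (hG : G.IsTree) (root : ι) : ∃ F : ParentTree ι, F.root = root ∧
      (∀ t, F.depth t ≤ Fintype.card ι) ∧ (∀ t, t ≠ root → G.Adj (F.parent t) t) ∧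
      ∀ a b, G.Adj a b → F.Adj a b := by
  classical
  choose p hp hpu using fun t => hG.existsUnique_path t root
  have hnil : ∀ t, t ≠ root → ¬ (p t).Nil := fun t ht => SimpleGraph.Walk.not_nil_of_ne ht
  refine ⟨⟨root, fun t => (p t).snd, fun t => (p t).length, ?_, ?_⟩, rfl, ?_, ?_, ?_⟩
  · rw [← hpu root .nil (by simp)]
    rfl
  · intro t ht
    rw [← hpu _ (p t).tail (hp t).tail]
    exact SimpleGraph.Walk.length_tail_add_one (hnil t ht)
  · exact fun t => (hp t).length_lt.le
  · exact fun t ht => ((p t).adj_snd (hnil t ht)).symm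
  · intro a b hab
    have hcase : ∀ a b, G.Adj a b → b ∈ (p a).support → a ≠ root ∧ b = (p a).snd := by
      intro a b hab hb
      refine ⟨?_, hG.isAcyclic.eq_snd_of_adj_start (hp a) hab hb⟩
      rintro rfl
      rw [← hpu a .nil (by simp)] at hb
      simp at hb
      exact hab.ne hb.symm
    by_cases hb : b ∈ (p a).support
    · exact .inl (hcase a b hab hb)
    · refine .inr (hcase b a hab.symm ?_)
      rw [← hpu b (.cons hab.symm (p a)) ((hp a).cons hb)]
      simp

end Tree

/-! ### Correctness -/

open Relation

/-- The reflexive-transitive closure is a partial order; extend it to a linear order and number each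
element by the size of its lower set. -/
theorem exists_injective_of_not_transGen {V : Type*} [Fintype V] (R : V → V → Prop)
    (h : ∀ x, ¬ TransGen R x x) :
    ∃ p : V → ℕ, Function.Injective p ∧ ∀ u v, R u v → p u < p v := by
  classical
  have : IsPartialOrder V (ReflTransGen R) :=
    { refl := fun _ => .refl
      trans := fun _ _ _ => ReflTransGen.trans
      antisymm := fun a b hab hba => by
        rcases reflTransGen_iff_eq_or_transGen.mp hab with h' | h'
        · exact h'.symm
        · exact absurd (TransGen.trans_left h' hba) (h a) }
  obtain ⟨s, hs, hRs⟩ := extend_partialOrder (ReflTransGen R)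
  have lt : ∀ u v, s u v → u ≠ v →
      (Finset.univ.filter fun w => s w u).card < (Finset.univ.filter fun w => s w v).card := by
    intro u v huv hne
    refine Finset.card_lt_card ((Finset.ssubset_iff_of_subset ?_).mpr ⟨v, ?_, ?_⟩)
    · intro w hw
      simp only [Finset.mem_filter, Finset.mem_univ, true_and] at hw ⊢
      exact hs.toIsPartialOrder.trans _ _ _ hw huv
    · simpa using hs.toIsPartialOrder.refl v
    · simpa using fun hvu => hne (hs.toIsPartialOrder.antisymm _ _ huv hvu)
  refine ⟨fun u => (Finset.univ.filter fun w => s w u).card, fun u v huv => ?_, fun u v huv => ?_⟩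
  · by_contra hne
    rcases hs.total u v with h' | h'
    · exact (lt u v h' hne).ne huv
    · exact (lt v u h' (Ne.symm hne)).ne huv.symm
  · refine lt u v (hRs _ _ (.single huv)) ?_
    rintro rfl
    exact h u (.single huv)

/-! ### States versus global colored orders. -/

namespace RawInput

variable {I : RawInput}

/-- Equal keys have equal colors and equal ranks within the intersection of the bags, and the ranks
determine the order. -/
theorem agree_of_key_eq (hk : 1 ≤ I.k) {t t' σ σ' : ℕ} (h : I.key t' t σ' = I.key t t' σ) :
    (∀ v < I.n, I.Bag t v → I.Bag t' v → I.col t' σ' v = I.col t σ v) ∧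
    ∀ u < I.n, ∀ v < I.n, I.Bag t u → I.Bag t' u → I.Bag t v → I.Bag t' v →
      (I.pos t' σ' u < I.pos t' σ' v ↔ I.pos t σ u < I.pos t σ v) := by
  have hcomm : I.Common t' t = I.Common t t' := by
    funext v
    exact propext and_comm
  rw [key, key, hcomm] at h
  have key := codeOf_inj I.n (fun v _ _ => codeCol_lt _ hk _ _) (fun v _ _ => codeCol_lt _ hk _ _) h
  refine ⟨fun v hv h₁ h₂ => (key v hv ⟨h₁, h₂⟩).1, fun u hu v hv h₁ h₂ h₃ h₄ => ?_⟩
  refine lt_iff_lt_of_cntBefore_eq (S := I.Common t t') I.n ?_ ?_ (fun v hv hC => (key v hv hC).2)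
    u hu v hv ⟨h₁, h₂⟩ ⟨h₃, h₄⟩
  · exact fun u hu v hv hCu hCv => codePos_injOn _ _ _ _ u hu v hv hCu.2 hCv.2
  · exact fun u hu v hv hCu hCv => codePos_injOn _ _ _ _ u hu v hv hCu.1 hCv.1

/-- The state `σ` of `t` encodes the coloring `c` and the order `p`. -/
def Matches (I : RawInput) (c p : ℕ → ℕ) (t σ : ℕ) : Prop :=
  (∀ v < I.n, I.Bag t v → I.col t σ v = c v) ∧
  ∀ u < I.n, ∀ v < I.n, I.Bag t u → I.Bag t v → (I.pos t σ u < I.pos t σ v ↔ p u < p v)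

theorem exists_matches (hk : 1 ≤ I.k) {c p : ℕ → ℕ} (hc : ∀ v, c v < I.k)
    (hp : ∀ u < I.n, ∀ v < I.n, p u = p v → u = v) (t : ℕ) :
    ∃ σ < I.states t, I.Matches c p t σ :=
  exists_code (I.Bag t) I.n c p hk hc fun u hu v hv _ _ => hp u hu v hv

/-- The neighbor's required state is the restriction of the same global solution, so both keys
encode the same colored order of the common vertices. -/
theorem Matches.alive (hk : 1 ≤ I.k) {c p : ℕ → ℕ} (hc : ∀ v, c v < I.k)
    (hp : ∀ u < I.n, ∀ v < I.n, p u = p v → u = v)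
    (h : ∀ u < I.n, ∀ v < I.n, I.Arc u v → c u = c v → p u < p v) (r : ℕ) :
    ∀ t σ, I.Matches c p t σ → I.Alive r t σ := by
  have valid : ∀ t σ, I.Matches c p t σ → I.Valid t σ := by
    intro t σ hm u hu v hv harc hBu hBv hcol
    rw [hm.1 u hu hBu, hm.1 v hv hBv] at hcol
    exact (hm.2 u hu v hv hBu hBv).mpr (h u hu v hv harc hcol)
  induction r with
  | zero => exact valid
  | succ r ih =>
    refine fun t σ hm => ⟨valid t σ hm, fun t' _ _ => ?_⟩
    obtain ⟨σ', hσ', hm'⟩ := exists_matches hk hc hp t'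
    have hcomm : I.Common t' t = I.Common t t' := by
      funext v
      exact propext and_comm
    refine ⟨σ', hσ', ih t' σ' hm', ?_⟩
    rw [key, key, hcomm]
    refine codeOf_congr I.n (fun v hv hC => ?_) fun u hu v hv hCu hCv => ?_
    · rw [hm.1 v hv hC.1, hm'.1 v hv hC.2]
    · rw [hm.2 u hu v hv hCu.1 hCv.1, hm'.2 u hu v hv hCu.2 hCv.2]

end RawInput

/-! ### From the input matrices back to the digraph and its decomposition. -/

theorem matrixArray_ne_zero {l m : ℕ} (R : Fin l → Fin m → Prop) (u : Fin l) (v : Fin m) :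
    matrixArray R (u * m + v) ≠ 0 ↔ R u v := by
  have : (∃ (u' : Fin l) (v' : Fin m), (u * m + v : ℕ) = u' * m + v' ∧ R u' v') ↔ R u v := by
    constructor
    · rintro ⟨u', v', h, hR⟩
      have h₂ := congrArg (· % m) h
      simp only [Nat.mul_add_mod_self_right, Nat.mod_eq_of_lt v.2, Nat.mod_eq_of_lt v'.2] at h₂
      rw [h₂] at h
      have h₁ := Nat.eq_of_mul_eq_mul_right v.pos (Nat.add_right_cancel h)
      rwa [Fin.ext h₁, Fin.ext h₂]
    · exact fun h => ⟨u, v, rfl, h⟩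
  simp [matrixArray, this]

variable {n N : ℕ} (D : Digraph (Fin n)) (X : TreeDecomposition D.toSimpleGraphInclusive (Fin N))
  (k : ℕ)

/-- The input in the memory. -/
noncomputable def rawInput : RawInput where
  n := n
  N := N
  k := k
  adj := matrixArray D.Adj
  tree := matrixArray X.tree.Adj
  inc := matrixArray fun t v => v ∈ X.bag t

theorem inputMem_holds : (inputMem D X k).Holds (rawInput D X k) :=
  ⟨rfl, rfl, rfl, rfl, rfl, rfl⟩

theorem rawInput_arc (u v : Fin n) : (rawInput D X k).Arc u v ↔ D.Adj u v :=
  matrixArray_ne_zero _ u v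

theorem rawInput_edge (t t' : Fin N) : (rawInput D X k).Edge t t' ↔ X.tree.Adj t t' :=
  matrixArray_ne_zero _ t t'

theorem rawInput_bag (t : Fin N) (v : Fin n) : (rawInput D X k).Bag t v ↔ v ∈ X.bag t :=
  matrixArray_ne_zero (fun t v => v ∈ X.bag t) t v

theorem exists_alive_of_diColorable (hk : 1 ≤ k) (h : D.DiColorable k) (r : ℕ) (t : Fin N) :
    ∃ σ < (rawInput D X k).states t, (rawInput D X k).Alive r t σ := by
  obtain ⟨c, hc⟩ := h
  have hacyc : ∀ x, ¬ TransGen (fun u v => D.Adj u v ∧ c u = c v) x x := by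
    intro x hx
    -- A walk along monochromatic arcs never leaves the color class of its start, so a closed one
    -- contradicts the acyclicity of that class.
    have lift : ∀ y, TransGen (fun u v => D.Adj u v ∧ c u = c v) x y →
        ∃ hy : c y = c x, TransGen (D.inducedOn {v | c v = c x}).Adj ⟨x, rfl⟩ ⟨y, hy⟩ := by
      intro y hy
      induction hy with
      | single h => exact ⟨h.2.symm, .single h.1⟩
      | tail _ h ih =>
        obtain ⟨hy, ih⟩ := ih
        exact ⟨h.2.symm.trans hy, ih.tail h.1⟩
    exact hc (c x) _ (lift x hx).2
  obtain ⟨p, hp, hlt⟩ := exists_injective_of_not_transGen _ hacyc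
  let c' : ℕ → ℕ := fun v => if h : v < n then c ⟨v, h⟩ else 0
  let p' : ℕ → ℕ := fun v => if h : v < n then p ⟨v, h⟩ else 0
  have hc' : ∀ v, c' v < (rawInput D X k).k := by
    intro v
    by_cases h : v < n
    · simp only [c', h, dif_pos]
      exact (c ⟨v, h⟩).2
    · simp only [c', h, dif_neg, not_false_eq_true]
      exact hk
  have hp' : ∀ u < (rawInput D X k).n, ∀ v < (rawInput D X k).n, p' u = p' v → u = v := by
    intro u (hu : u < n) v (hv : v < n) he
    simp only [p', hu, hv, dif_pos] at he
    simpa using hp he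
  have harc : ∀ u < (rawInput D X k).n, ∀ v < (rawInput D X k).n, (rawInput D X k).Arc u v →
      c' u = c' v → p' u < p' v := by
    intro u (hu : u < n) v (hv : v < n) ha he
    simp only [c', p', hu, hv, dif_pos] at he ⊢
    exact hlt _ _ ⟨(rawInput_arc D X k ⟨u, hu⟩ ⟨v, hv⟩).mp ha, Fin.ext he⟩
  obtain ⟨σ, hσ, hm⟩ := RawInput.exists_matches (I := rawInput D X k) hk hc' hp' t
  exact ⟨σ, hσ, hm.alive hk hc' hp' harc r⟩

theorem TreeDecomposition.reflTransGen {V ι : Type*} {G : SimpleGraph V}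
    (X : TreeDecomposition G ι) {v : V} {t t' : ι} (ht : v ∈ X.bag t) (ht' : v ∈ X.bag t') :
    ReflTransGen (fun a b => v ∈ X.bag b ∧ X.tree.Adj a b) t t' := by
  obtain ⟨w⟩ := X.preconnected v ⟨t, ht⟩ ⟨t', ht'⟩
  have : ∀ (a b : {t | v ∈ X.bag t}), (X.tree.induce {t | v ∈ X.bag t}).Walk a b →
      ReflTransGen (fun a b => v ∈ X.bag b ∧ X.tree.Adj a b) a.1 b.1 := by
    intro a b w
    induction w with
    | nil => exact .refl
    | @cons a b c h w ih => exact .head ⟨b.2, h⟩ ih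
  exact this _ _ w

/-- Each vertex takes its color from an arbitrary node `node v` whose bag contains it. The union of
the bag orders contains all monochromatic arcs and is acyclic. -/
theorem diColorable_of_alive (hk : 1 ≤ k) (hloop : ∀ v, ¬ D.Adj v v) (root : Fin N) (σ₀ : ℕ)
    (h : (rawInput D X k).Alive N root σ₀) : D.DiColorable k := by
  set I := rawInput D X k with hI
  obtain ⟨F, rfl, hdepth, hpar, hadj⟩ := X.isTree.exists_parentTree root
  obtain ⟨f, hf⟩ := F.exists_assignment (fun r t σ => I.Alive r t σ)
    (fun t σ t' σ' => I.key t' t σ' = I.key t t' σ) N (by simpa using hdepth) σ₀ h (by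
      rintro r t a ht ⟨_, h⟩
      obtain ⟨b, _, hb⟩ := h t t.2 ((rawInput_edge D X k _ _).mpr (hpar t ht))
      exact ⟨b, hb⟩)
  have hvalid : ∀ t : Fin N, I.Valid t (f t) := fun t =>
    ((RawInput.alive_iff _ _ _).mp (hf t).1).1
  have hbag : ∀ (t : Fin N) (v : Fin n), I.Bag t v ↔ v ∈ X.bag t := rawInput_bag D X k
  have hag := fun t ht => RawInput.agree_of_key_eq (I := I) hk ((hf t).2 ht)
  have hcolpar : ∀ (t : Fin N), t ≠ F.root → ∀ v : Fin n, v ∈ X.bag t → v ∈ X.bag (F.parent t) →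
      I.col t (f t) v = I.col (F.parent t) (f (F.parent t)) v := fun t ht v h₁ h₂ =>
    (hag t ht).1 v v.2 ((hbag _ _).mpr h₂) ((hbag _ _).mpr h₁)
  choose node hnode using X.exists_mem_bag
  have hcol : ∀ (v : Fin n) (t t' : Fin N), v ∈ X.bag t → v ∈ X.bag t' →
      I.col t (f t) v = I.col t' (f t') v := by
    intro v t t' ht ht'
    -- Membership in the current bag is carried along the path, since keys control colors only on
    -- common vertices.
    have : v ∈ X.bag t' ∧ I.col t (f t) v = I.col t' (f t') v := by
      induction X.reflTransGen ht ht' with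
      | refl => exact ⟨ht, rfl⟩
      | @tail a b _ hab ih =>
        obtain ⟨ha, ih⟩ := ih (by
          rename_i h'
          exact (ReflTransGen.cases_tail h').elim (fun h => h ▸ ht) fun ⟨c, _, h⟩ => h.1)
        refine ⟨hab.1, ih.trans ?_⟩
        rcases hadj a b hab.2 with ⟨hr, rfl⟩ | ⟨hr, rfl⟩
        · exact hcolpar a hr v ha hab.1
        · exact (hcolpar b hr v hab.1 ha).symm
    exact this.2
  let L : Fin N → Fin n → Fin n → Prop := fun t u v =>
    u ∈ X.bag t ∧ v ∈ X.bag t ∧ I.pos t (f t) u < I.pos t (f t) v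
  have hacyc := F.not_transGen_exists (fun t v => v ∈ X.bag t) L (fun t x y h => ⟨h.1, h.2.1⟩)
    (fun t x y z h₁ h₂ => ⟨h₁.1, h₂.2.1, h₁.2.2.trans h₂.2.2⟩) (fun t x h => lt_irrefl _ h.2.2)
    (fun t ht x y hx hy h => ⟨hx, hy, ((hag t ht).2 x x.2 y y.2 ((hbag _ _).mpr hx)
      ((hbag _ _).mpr h.1) ((hbag _ _).mpr hy) ((hbag _ _).mpr h.2.1)).mp h.2.2⟩)
    (fun x t t' ht ht' => ReflTransGen.mono (fun a b h => ⟨h.1, hadj a b h.2⟩) _ _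
      (X.reflTransGen ht ht'))
  refine ⟨fun v => ⟨I.col (node v) (f (node v)) v, codeCol_lt _ hk _ _⟩, fun i v hv => ?_⟩
  refine hacyc v.1 (TransGen.lift Subtype.val ?_ _ _ hv)
  rintro ⟨u, hu⟩ ⟨w, hw⟩ (huw : D.Adj u w)
  have huw' : D.toSimpleGraphInclusive.Adj u w := by
    refine (SimpleGraph.fromRel_adj _ _ _).mpr ⟨?_, .inl huw⟩
    rintro rfl
    exact hloop u huw
  obtain ⟨t, hut, hwt⟩ := X.exists_adj_bag u w huw'
  refine ⟨t, hut, hwt, hvalid t u u.2 w w.2 ((rawInput_arc D X k u w).mpr huw)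
    ((hbag _ _).mpr hut) ((hbag _ _).mpr hwt) ?_⟩
  rw [hcol u t (node u) hut (hnode u), hcol w t (node w) hwt (hnode w)]
  exact congrArg Fin.val ((show _ = i from hu).trans (show _ = i from hw).symm)

/-! ### The time bound -/

namespace WordRAM

theorem Expr.Fits.mono {W W' : ℕ} (h : W ≤ W') {s : Mem} {e : Expr} (he : e.Fits W s) :
    e.Fits W' s := by
  induction e with
  | lit | var => exact le_trans he h
  | get a e ih => exact ⟨ih he.1, he.2.trans h⟩
  | add e f ihe ihf | mul e f ihe ihf => exact ⟨ihe he.1, ihf he.2.1, he.2.2.trans h⟩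
  | sub e f ihe ihf | div e f ihe ihf => exact ⟨ihe he.1, ihf he.2⟩

theorem Run.mono {W W' : ℕ} (h : W ≤ W') {p : Prog} {s s' : Mem} {t : ℕ} (hr : Run W p s t s') :
    Run W' p s t s' := by
  induction hr with
  | skip s => exact .skip s
  | set s x e he => exact .set s x e (he.mono h)
  | put s a e f he hf => exact .put s a e f (he.mono h) (hf.mono h)
  | seq _ _ ih₁ ih₂ => exact .seq ih₁ ih₂
  | ite_true he h' _ ih => exact .ite_true (he.mono h) h' ih
  | ite_false he h' _ ih => exact .ite_false (he.mono h) h' ih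
  | while_true he h' _ _ ih₁ ih₂ => exact .while_true (he.mono h) h' ih₁ ih₂
  | while_false he h' => exact .while_false (he.mono h) h'

open Classical in
-- The size bounds are assumed only for `k < n`, because for `k ≥ n` the rounds are skipped.
theorem main_spec {I : RawInput} {Z S : ℕ} {s : Mem} (hI : s.Holds I)
    (hZ : I.k < I.n → I.BddBy Z ∧ I.N + 1 ≤ Z) (hN : 1 ≤ I.N) (hS1 : 1 ≤ S)
    (hS : I.k < I.n → ∀ t < I.N, I.states t ≤ S) (htab : ∀ j, s.arr 5 j = 0) :
    Spec Z mainP s (4000 * (I.n + 1) ^ 2 * (I.N + 1) ^ 3 * S + 10) fun s' => s'.var 0 =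
      if I.k < I.n → ∃ σ < I.states (I.N - 1), I.Alive I.N (I.N - 1) σ then 1 else 0 := by
  refine Spec.of_bdd fun hs => ?_
  have hone : 1 ≤ Z := by have := hs.two_le; omega
  refine Spec.le (Spec.seq (Q' := fun s' => s'.var 7 =
    if I.k < I.n → ∃ σ < I.states (I.N - 1), I.Alive I.N (I.N - 1) σ then 1 else 0)
    (Spec.ite (T := 4000 * (I.n + 1) ^ 2 * (I.N + 1) ^ 3 * S + 3) rfl (fun h => ?_) fun h => ?_)
    (T₂ := 2) ?_) (by simp only [Expr.cost]; omega)
  · have hlt : I.k < I.n := by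
      simp only [Expr.eval, hI.n, hI.k] at h
      omega
    refine ((rounds_spec hI (hZ hlt).1 hN (hZ hlt).2 hS1 (hS hlt) htab).le (by omega)).imp ?_
    intro s' _ _ h'
    simpa [hlt] using h'
  · have hlt : ¬ I.k < I.n := by
      simp only [Expr.eval, hI.n, hI.k] at h
      omega
    refine (Spec.set rfl rfl hone ?_).le (by simp only [Expr.cost]; omega)
    simp [hlt, Expr.eval]
  · intro s' hs' _ h7
    exact Spec.set rfl rfl (hs'.var_le 7) (by simpa [Expr.eval] using h7)

end WordRAM

theorem Digraph.diColorable_of_le {n k : ℕ} (D : Digraph (Fin n)) (hloop : ∀ v, ¬ D.Adj v v)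
    (h : n ≤ k) : D.DiColorable k := by
  refine ⟨Fin.castLE h, fun i v hv => ?_⟩
  obtain ⟨w, hvw, -⟩ := Relation.TransGen.head'_iff.mp hv
  have : v = w := Subtype.ext (Fin.castLE_injective h (v.2.trans w.2.symm))
  subst this
  exact hloop v hvw

theorem TreeDecomposition.card_bag_le {V ι : Type*} [Fintype ι] {G : SimpleGraph V}
    (X : TreeDecomposition G ι) (t : ι) : (X.bag t).card ≤ X.width + 1 := by
  have := Finset.le_sup (f := fun t => (X.bag t).card) (Finset.mem_univ t)
  simp only [width] at this ⊢
  omega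

theorem TreeDecomposition.width_add_one_le {n : ℕ} {ι : Type*} [Fintype ι]
    {G : SimpleGraph (Fin n)} (X : TreeDecomposition G ι) (hn : 1 ≤ n) : X.width + 1 ≤ n := by
  have : (Finset.univ.sup fun t => (X.bag t).card) ≤ n :=
    Finset.sup_le fun t _ => card_finset_fin_le _
  simp only [width]
  omega

/-- This is where exponent and factorial drop from tw + 1 to tw: the factor k(tw + 1) is absorbed
into (n + N)², using k < n and tw + 1 ≤ n. -/
theorem rawInput_states_le {n N k : ℕ} (hk : 1 ≤ k) (D : Digraph (Fin n))
    (X : TreeDecomposition D.toSimpleGraphInclusive (Fin N)) (hkn : k < n) :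
    ∀ t < N, (rawInput D X k).states t ≤ (n + N) ^ 2 * (k ^ X.width * X.width.factorial) := by
  classical
  intro t ht
  have hcnt : cntBelow ((rawInput D X k).Bag t) n ≤ X.width + 1 := by
    refine le_trans (le_of_eq ?_) (X.card_bag_le ⟨t, ht⟩)
    rw [cntBelow, Nat.count_eq_card_filter_range]
    symm
    refine Finset.card_bij (fun v _ => (v : ℕ)) ?_ ?_ ?_
    · intro v hv
      simpa using (rawInput_bag D X k ⟨t, ht⟩ v).mpr hv
    · exact fun v _ w _ h => Fin.ext h
    · intro v hv
      simp only [Finset.mem_filter, Finset.mem_range] at hv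
      exact ⟨⟨v, hv.1⟩, (rawInput_bag D X k ⟨t, ht⟩ ⟨v, hv.1⟩).mp hv.2, rfl⟩
  have hw := X.width_add_one_le (by omega)
  calc (rawInput D X k).states t
      ≤ k ^ (X.width + 1) * (X.width + 1).factorial :=
        Nat.mul_le_mul (Nat.pow_le_pow_right hk hcnt) (Nat.factorial_le hcnt)
    _ = k * (X.width + 1) * (k ^ X.width * X.width.factorial) := by
        rw [pow_succ, Nat.factorial_succ]; ring
    _ ≤ (n + N) * (n + N) * (k ^ X.width * X.width.factorial) := by gcongr <;> omega
    _ = _ := by rw [sq]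

open Classical in
theorem mainTheorem6 :
    ∃ (P : WordRAM.Prog) (C : ℕ),
      ∀ (n N k : ℕ) (_ : 1 ≤ k) (D : Digraph (Fin n)) (_ : ∀ v, ¬ D.Adj v v)
        (X : TreeDecomposition D.toSimpleGraphInclusive (Fin N)),
        ∃ (t : ℕ) (s : WordRAM.Mem),
          WordRAM.Run ((k + timeBound C k X.width (n + N)) ^ C) P (inputMem D X k) t s ∧
          t ≤ timeBound C k X.width (n + N) ∧
          s.var 0 = if D.DiColorable k then 1 else 0 := by
  -- A single generous constant: it must exceed the word exponent 64, the degree 7 and the factor of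
  -- the running time computed at the end.
  obtain ⟨C, hC⟩ : ∃ C, C = 200000 := ⟨_, rfl⟩
  refine ⟨WordRAM.mainP, C, fun n N k hk D hloop X => ?_⟩
  have hN : 1 ≤ N := by
    obtain ⟨t⟩ := X.isTree.connected.nonempty
    have := t.2
    omega
  set Y := k ^ X.width * X.width.factorial with hY
  have hY1 : 1 ≤ Y := Nat.mul_pos (Nat.pow_pos hk) (Nat.factorial_pos _)
  have hpow : (n + N) ^ 7 ≤ (n + N) ^ C := Nat.pow_le_pow_right (by omega) (by omega)
  have hT : timeBound C k X.width (n + N) = C * (Y * (n + N) ^ C) := rfl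
  have hYT : 200000 * ((n + N) ^ 7 * Y) ≤ timeBound C k X.width (n + N) := by
    rw [hT, mul_comm Y, ← hC]
    gcongr
  set T := timeBound C k X.width (n + N) with hTdef
  have hLY : ∀ i ≤ 7, (n + N) ^ i * Y ≤ (n + N) ^ 7 * Y := fun i hi =>
    Nat.mul_le_mul_right _ (Nat.pow_le_pow_right (by omega) hi)
  have hL1 : n + N ≤ (n + N) ^ 7 * Y :=
    calc n + N = (n + N) ^ 1 * 1 := by ring
      _ ≤ (n + N) ^ 1 * Y := by gcongr
      _ ≤ _ := hLY 1 (by norm_num)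
  have hL2 : (n + N) ^ 2 * Y ≤ (n + N) ^ 7 * Y := hLY 2 (by norm_num)
  have hbdd : (inputMem D X k).Bdd (k + T) := by
    refine ⟨by omega, ?_, ?_⟩
    · rintro (_ | _ | _ | x) <;> (simp only [inputMem]; omega)
    · have : ∀ {l m : ℕ} (R : Fin l → Fin m → Prop) (i : ℕ), matrixArray R i ≤ k + T := by
        intro l m R i
        rw [matrixArray]
        split_ifs <;> omega
      rintro (_ | _ | _ | a) i <;> simp only [inputMem, this] <;> omega
  have hS : k < n → ∀ t < N, (rawInput D X k).states t ≤ (n + N) ^ 2 * Y :=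
    rawInput_states_le hk D X
  have hkn : k < n → k * n ≤ k + T ∧ N + 1 ≤ k + T := by
    intro hkn
    have : k * n ≤ (n + N) ^ 2 * Y :=
      calc k * n ≤ (n + N) * (n + N) := Nat.mul_le_mul (by omega) (by omega)
        _ = (n + N) ^ 2 * 1 := by ring
        _ ≤ _ := Nat.mul_le_mul_left _ hY1
    omega
  obtain ⟨t, s, hrun, ht, -, hs⟩ := WordRAM.main_spec (I := rawInput D X k) (Z := k + T)
    (S := (n + N) ^ 2 * Y) (inputMem_holds D X k)
    (fun h => ⟨⟨hk, (hkn h).1, fun t ht => (hS h t ht).trans (by omega)⟩, (hkn h).2⟩) hN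
    (Nat.mul_pos (Nat.pow_pos (by omega)) hY1) hS (fun _ => rfl) hbdd
  refine ⟨t, s, hrun.mono (Nat.pow_le_pow_right (by omega) (by omega)), ht.trans ?_, ?_⟩
  · refine le_trans ?_ hYT
    have h₁ : (n + 1) ^ 2 ≤ (n + N) ^ 2 := Nat.pow_le_pow_left (by omega) 2
    -- As N ≥ 1, n + 1 is at most n + N, but N + 1 may exceed it when n = 0; hence the factor 2, and
    -- 4000 · 2³ = 32000. The degree 7 is 2 + 3 from the loops plus 2 from the number of states.
    have h₂ : (N + 1) ^ 3 ≤ (2 * (n + N)) ^ 3 := Nat.pow_le_pow_left (by omega) 3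
    calc 4000 * (n + 1) ^ 2 * (N + 1) ^ 3 * ((n + N) ^ 2 * Y) + 10
        ≤ 4000 * (n + N) ^ 2 * (2 * (n + N)) ^ 3 * ((n + N) ^ 2 * Y) + 10 := by gcongr
      _ = 32000 * ((n + N) ^ 7 * Y) + 10 := by ring
      _ ≤ _ := by omega
  · rw [hs]
    congr 1
    rw [eq_iff_iff]
    constructor
    · intro h
      by_cases hkn : k < n
      · obtain ⟨σ, _, hσ⟩ := h hkn
        exact diColorable_of_alive D X k hk hloop ⟨N - 1, by omega⟩ σ hσ
      · exact D.diColorable_of_le hloop (by omega)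
    · intro h _
      exact exists_alive_of_diColorable D X k hk h N ⟨N - 1, by omega⟩
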